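/- \textbf{Setting.} For $d\ge 1$, $p,q\in(0,1)$ with $p+q>1$, put $\sigma=1/\sqrt d$, $\gamma=\sigma\Phi^{-1}(q)$ and $m=\sigma\,\phi(\gamma/\sigma)\bigl(\frac{p}{1-q}-\frac{1-p}{q}\bigr)$, where $\phi,\Phi$ are the standard normal density and distribution function. On input a unit vector $v\in\mathbb R^d$, the randomizer $\mathrm{PrivUnitG}_{d}(p,q)$ draws $U\sim N(0,\sigma^2)$ conditioned on $U\ge\gamma$ with probability $p$ and conditioned on $U<\gamma$ with probability $1-p$, calls the result $\alpha$, draws independently $V^\perp\sim N(0,\sigma^2(I-vv^\top))$, and returns $\frac1m(\alpha v+V^\perp)$. For $\varepsilon>0$, the parameters $(p,q)$ are \emph{optimal for $(\varepsilon,d)$} if they minimize the worst-case (over unit vectors $v$) expected squared error of $\mathrm{PrivUnitG}_d(p,q)$ among all such $(p,q)$ with $\frac{p}{1-q}\le e^{\varepsilon}\,\frac{1-p}{q}$. Let $\mathrm{err}_{n,d}(\mathrm{PrivUnitG})$ be the supremum over unit vectors $v_1,\dots,v_n\in\mathbb R^d$ of the expected squared error, as an estimate of $\frac1n\sum_i v_i$,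 of the average of the independent messages $\mathrm{PrivUnitG}_d(p,q)(v_i)$, with $(p,q)$ optimal for $(\varepsilon,d)$. For $1\le k\le d$ let $W=\sqrt{d/k}\,SU\in\mathbb R^{k\times d}$, where $U$ is Haar distributed on the orthogonal group $O(d)$ and $S$ is an independent uniformly random $k\times d$ sampling matrix (each row has a single $1$, in distinct positions). Let $$c=\sqrt{\tfrac kd}\;\frac{\Gamma((d+1)/2)\,\Gamma(k/2)}{\Gamma((k+1)/2)\,\Gamma(d/2)} .$$ On input a unit vector $v\in\mathbb R^d$ the client randomizer $\mathcal R$ draws $W$, sets $u=Wv/\|Wv\|_2$ and $\hat u=c\cdot\mathrm{PrivUnitG}_k(p,q)(u)$ with $(p,q)$ optimal for $(\varepsilon,k)$ and fresh randomness independent of $W$, and sends $(W,\hat u)$. From the messages $(W_i,\hat u_i)$ of $n$ clients with inputs $v_1,\dots,v_n$, randomizing independently, the server computes $\hat\mu=\frac1n\sum_{i=1}^n W_i^\top\hat u_i$. \textbf{Theorem.} Optimal parameters exist for all $\varepsilon>0$ and $d\ge1$. For all $\varepsilon>0$, $1\le k\le d$, and any choice of optimal parameters: \begin{enumerate} \item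 for every unit vector $v\in\mathbb R^d$, $\mathbb E[c\,W^\top u]=v$ and $\mathbb E[W^\top\hat u]=v$ (both random vectors being integrable); \item $\mathcal R$ is $\varepsilon$-DP on unit vectors: $\Pr[\mathcal R(v)\in A]\le e^{\varepsilon}\Pr[\mathcal R(w)\in A]$ for all unit vectors $v,w$ and all measurable sets $A$ of messages $(W,\hat u)$; \item for every $n\ge1$ and all unit vectors $v_1,\dots,v_n\in\mathbb R^d$, $$\mathbb E\Bigl\|\hat\mu-\frac1n\sum_{i=1}^n v_i\Bigr\|_2^2\le \mathrm{err}_{n,d}(\mathrm{PrivUnitG})\Bigl(1+C\,\frac{\varepsilon+\log k}{k}\Bigr).$$ Here $C$ can be taken to be a universal constant as long as $k\ge2$; and for each $\varepsilon>0$ there is a constant $C$ depending only on $\varepsilon$ for which the bound holds for all $1\le k\le d$ and all $n\ge 1$. \end{enumerate} -/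

import Mathlib

open MeasureTheory ProbabilityTheory
open scoped ENNReal NNReal Matrix

noncomputable section

/-! ### Matrices as a measurable space, and the compact orthogonal group -/

instance instMeasurableSpaceRealMatrix {m n : Type*} : MeasurableSpace (Matrix m n ℝ) :=
  inferInstanceAs (MeasurableSpace (m → n → ℝ))

instance instBorelSpaceRealMatrix {m n : Type*} [Countable m] [Countable n] :
    BorelSpace (Matrix m n ℝ) :=
  inferInstanceAs (BorelSpace (m → n → ℝ))

instance instCompactSpaceOrthogonalGroup (d : ℕ) :
    CompactSpace (Matrix.orthogonalGroup (Fin d) ℝ) := by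
  refine isCompact_iff_compactSpace.1
    (?_ : IsCompact (Matrix.orthogonalGroup (Fin d) ℝ : Set (Matrix (Fin d) (Fin d) ℝ)))
  have hbig : IsCompact (Set.pi Set.univ (fun _ : Fin d =>
      Set.pi Set.univ (fun _ : Fin d => Set.Icc (-1 : ℝ) 1))) :=
    isCompact_univ_pi fun _ => isCompact_univ_pi fun _ => isCompact_Icc
  refine IsCompact.of_isClosed_subset (X := Fin d → Fin d → ℝ) hbig ?_ ?_
  · exact isClosed_unitary (R := Matrix (Fin d) (Fin d) ℝ)
  · rintro (A : Matrix (Fin d) (Fin d) ℝ) hA i _ j _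
    have h1 : A * Aᵀ = 1 := Matrix.mem_orthogonalGroup_iff (Fin d) ℝ |>.1 hA
    have h2 : ∑ l, A i l * A i l = 1 := by
      have := congrFun (congrFun h1 i) i
      simpa [Matrix.mul_apply] using this
    have h3 : A i j * A i j ≤ 1 := by
      rw [← h2]
      exact Finset.single_le_sum (f := fun l => A i l * A i l)
        (fun l _ => mul_self_nonneg _) (Finset.mem_univ j)
    exact abs_le.1 ((sq_le_one_iff_abs_le_one _).1 (by rw [sq]; exact h3))

instance instMeasurableSpaceFinEmbedding (k d : ℕ) : MeasurableSpace (Fin k ↪ Fin d) := ⊤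

/-- Euclidean space `ℝ^d`. -/
abbrev Euc (d : ℕ) : Type := EuclideanSpace ℝ (Fin d)

/-- The matrix-vector product `A v`, as a map of Euclidean spaces. -/
def matVec {k d : ℕ} (A : Matrix (Fin k) (Fin d) ℝ) (v : Euc d) : Euc k :=
  WithLp.toLp 2 (A *ᵥ v.ofLp)

/-- `x / ‖x‖`. -/
def normalizeVec {k : ℕ} (x : Euc k) : Euc k := ‖x‖⁻¹ • x

/-! ### Local differential privacy, protocols and their error -/

/-- A randomizer `R` (given by the law `R v` of its message on input `v`) is `ε`-DP
on unit vectors. -/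
def IsLocallyDP {M : Type*} [MeasurableSpace M] {d : ℕ} (ε : ℝ) (R : Euc d → Measure M) : Prop :=
  ∀ v w : Euc d, ‖v‖ = 1 → ‖w‖ = 1 → ∀ S : Set M, MeasurableSet S →
    R v S ≤ ENNReal.ofReal (Real.exp ε) * R w S

/-- The mean `(1/n) ∑ v_i`. -/
def meanVec {n d : ℕ} (v : Fin n → Euc d) : Euc d := (n : ℝ)⁻¹ • ∑ i, v i

/-- `E ‖A(R(v_1), …, R(v_n)) - (1/n) ∑ v_i‖²`, the users randomizing independently. -/
def protocolMSE {M : Type*} [MeasurableSpace M] {n d : ℕ}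
    (A : (Fin n → M) → Euc d) (R : Euc d → Measure M) (v : Fin n → Euc d) : ℝ≥0∞ :=
  ∫⁻ m, ‖A m - meanVec v‖ₑ ^ 2 ∂(Measure.pi fun i => R (v i))

/-- The worst-case mean squared error of a protocol over unit vectors `v_1, …, v_n`. -/
def protocolErr {M : Type*} [MeasurableSpace M] {n d : ℕ}
    (A : (Fin n → M) → Euc d) (R : Euc d → Measure M) : ℝ≥0∞ :=
  ⨆ v : Fin n → Metric.sphere (0 : Euc d) 1, protocolMSE A R (fun i => (v i : Euc d))

/-! ### The randomizer PrivUnitG -/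

/-- The quantile function `Φ⁻¹` of the standard normal distribution, for `q ∈ (0,1)`. -/
def stdNormalQuantile (q : ℝ) : ℝ := sInf {x : ℝ | q ≤ cdf (gaussianReal 0 1) x}

/-- `σ = 1/√d`. -/
def pugSigma (d : ℕ) : ℝ := Real.sqrt (1 / d)

/-- The threshold `γ = σ Φ⁻¹(q)`. -/
def pugGamma (d : ℕ) (q : ℝ) : ℝ := pugSigma d * stdNormalQuantile q

/-- `m = σ φ(γ/σ) (p/(1-q) - (1-p)/q)`. -/
def pugM (d : ℕ) (p q : ℝ) : ℝ :=
  pugSigma d * gaussianPDFReal 0 1 (pugGamma d q / pugSigma d) * (p / (1 - q) - (1 - p) / q)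

/-- The law of `α`: with probability `p` it is `U` conditioned on `U ≥ γ`, with probability
`1 - p` it is `U` conditioned on `U < γ`, where `U ∼ N(0, 1/d)`. -/
def pugAlphaLaw (d : ℕ) (p q : ℝ) : Measure ℝ :=
  ENNReal.ofReal p • (gaussianReal 0 (1 / d))[|Set.Ici (pugGamma d q)] +
    ENNReal.ofReal (1 - p) • (gaussianReal 0 (1 / d))[|Set.Iio (pugGamma d q)]

/-- The internal randomness of PrivUnitG: `α` and an independent standard Gaussian vector `g`. -/
def pugCoins (d : ℕ) (p q : ℝ) : Measure (ℝ × Euc d) :=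
  (pugAlphaLaw d p q).prod (stdGaussian (Euc d))

/-- The output `(1/m) (α v + V^⊥)` of PrivUnitG on the unit vector `v`, where
`V^⊥ = σ (g - ⟨v, g⟩ v)` has law `N(0, σ² (I - v vᵀ))`. -/
def pugOutput {d : ℕ} (p q : ℝ) (v : Euc d) (ω : ℝ × Euc d) : Euc d :=
  (1 / pugM d p q) • (ω.1 • v + pugSigma d • (ω.2 - (inner ℝ v ω.2) • v))

/-- The local randomizer PrivUnitG with parameters `p, q` in dimension `d`. -/
def pug (d : ℕ) (p q : ℝ) (v : Euc d) : Measure (Euc d) :=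
  (pugCoins d p q).map (pugOutput p q v)

/-- The error of the `n`-user PrivUnitG protocol, whose server averages the messages. -/
def pugErr (n d : ℕ) (p q : ℝ) : ℝ≥0∞ := protocolErr (n := n) meanVec (pug d p q)

/-- The parameters for which PrivUnitG is `ε`-DP: the density of its output (before scaling, with
respect to `N(0, σ² I)`) is `p/(1-q)` on a cap and `(1-p)/q` off it. The condition `1 < p + q` says
that `m > 0`; nothing is lost, as `(p, q)` and `(1 - p, 1 - q)` give the same randomizer. -/
def PugAdmissible (ε p q : ℝ) : Prop :=
  0 < p ∧ p < 1 ∧ 0 < q ∧ q < 1 ∧ 1 < p + q ∧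
    p / (1 - q) ≤ Real.exp ε * ((1 - p) / q)

/-- Parameters that minimize the mean squared error in dimension `d` under the `ε`-DP constraint. -/
def PugOptimal (ε : ℝ) (d : ℕ) (p q : ℝ) : Prop :=
  PugAdmissible ε p q ∧ ∀ p' q' : ℝ, PugAdmissible ε p' q' → pugErr 1 d p q ≤ pugErr 1 d p' q'

/-! ### The projected randomizer with random rotations -/

/-- The sampling matrix `S`, whose `i`-th row is the standard basis vector `e_{s i}`. -/
def samplingMatrix {k d : ℕ} (s : Fin k ↪ Fin d) : Matrix (Fin k) (Fin d) ℝ :=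
  fun i j => if j = s i then 1 else 0

/-- The law of `W = √(d/k) S U`, with `U` Haar distributed on the orthogonal group and `S` an
independent uniformly random sampling matrix without repetitions. -/
def rotationLaw (k d : ℕ) : Measure (Matrix (Fin k) (Fin d) ℝ) :=
  ((uniformOn (Set.univ : Set (Fin k ↪ Fin d))).prod
      (Measure.haarMeasure (⊤ : TopologicalSpace.PositiveCompacts
        (Matrix.orthogonalGroup (Fin d) ℝ)))).map
    fun x => Real.sqrt (d / k) •
      (samplingMatrix x.1 * (x.2 : Matrix (Fin d) (Fin d) ℝ))

/-- `c = √(k/d) Γ((d+1)/2) Γ(k/2) / (Γ((k+1)/2) Γ(d/2))`. -/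
def unbiasConst (k d : ℕ) : ℝ :=
  Real.sqrt (k / d) * (Real.Gamma ((d + 1) / 2) * Real.Gamma (k / 2)) /
    (Real.Gamma ((k + 1) / 2) * Real.Gamma (d / 2))

/-- The client: the law of the message `(W, û)`, where `û = c · PrivUnitG(u)`, `u = W v / ‖W v‖`,
and PrivUnitG runs in dimension `k` with parameters `p, q`. -/
def projRandomizer (k d : ℕ) (p q : ℝ) (v : Euc d) :
    Measure (Matrix (Fin k) (Fin d) ℝ × Euc k) :=
  ((rotationLaw k d).prod (pugCoins k p q)).map
    fun x => (x.1, unbiasConst k d • pugOutput p q (normalizeVec (matVec x.1 v)) x.2)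

/-- The decoding `Wᵀ û` of a single message. -/
def decodeMsg {k d : ℕ} (m : Matrix (Fin k) (Fin d) ℝ × Euc k) : Euc d := matVec m.1ᵀ m.2

/-- The server: `μ̂ = (1/n) ∑ W_iᵀ û_i`. -/
def projAggregate {n k d : ℕ} (m : Fin n → Matrix (Fin k) (Fin d) ℝ × Euc k) : Euc d :=
  meanVec fun i => decodeMsg (m i)

end

/-!
Let `t = Φ⁻¹(q)` and let `s = φ(t) (p / (1 - q) - (1 - p) / q)` be the standardised mean of the
radial coin `α` (`pugSignal`). All Gaussian computations reduce to the truncated moments of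
`N(0, 1)`: the standardised `α` has mean `s` and second moment `1 + t s`, so that PrivUnitG is
unbiased with `E ‖PrivUnitG(v)‖² = F_d := d / s² + t / s` (`pugSecondMoment`), and the error of
the average of `n` messages is `(F_d - 1) / n` (`pugErr_eq`). That the variance of `α` is
nonnegative gives `s² ≤ 1 + t s` (`pugSignal_sq_le`), the inequality behind most of the estimates.

*Optimal parameters.* For fixed `q` the error decreases with `p`, by the variance inequality, so
the privacy constraint may be taken to be tight. What remains is a continuous function of `t` that
tends to infinity as `|t| → ∞`, and so attains its minimum (`exists_pugOptimal`).

*Privacy.* The law of `α` has a density between `(1 - p) / q` and `p / (1 - q)` with respect to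
the centred Gaussian, and if `α` were Gaussian the output would be a Gaussian vector whose law
does not depend on the input (`map_recombine_gaussian`). The projected randomizer inherits privacy
by conditioning on `W`.

*Unbiasedness.* The law of `W` is invariant under right multiplication by orthogonal matrices, so
the mean of `Wᵀ u` is fixed by the reflection in the line spanned by `v`; it is a multiple of `v`
with coefficient `E ‖W v‖`. Applying `W` to an independent standard Gaussian vector `g` of `ℝ^d`
and using that `W g` is `√(d/k)` times a standard Gaussian vector of `ℝ^k`, one gets
`E ‖g‖ · E ‖W v‖ = √(d/k) E ‖g_k‖`, and the mean norms of Gaussian vectors are quotients of values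
of the Gamma function; hence `E ‖W v‖ = 1 / c` (`unbiasConst_mul_integral_norm`). The same
argument shows that `W v ≠ 0` almost surely.

*Error.* As `W Wᵀ = (d/k) I`, the message has second moment `G F_k` with `G = (d/k) c²`, and
log-convexity of the Gamma function gives `G ≤ d / (k - 1)` for `k ≥ 2`. Let `s`, `t` belong to
the optimal parameters for dimension `d`. These are admissible in dimension `k`, so
`F_k ≤ k / s² + t / s`, while the variance inequality gives `F_d - 1 ≥ (d - 1) / s²`, which is of
order `d / s²` for `d ≥ 2`. Hence the excess error is at most `(F_d - 1) O(1 + max (t s) 0) / k`,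
and `t s ≤ 1 + 8 ε` (`quantile_mul_pugSignal_le`). For `k = 1` the bound `G ≤ d π / 2` takes the
place of `G ≤ d / (k - 1)`. See `inflated_error_le`.
-/

/-! ### The standard normal distribution function and its quantiles -/

open Filter Topology in
theorem continuous_cdf_of_nullSingleton (μ : Measure ℝ) [IsProbabilityMeasure μ]
    [NullSingletonClass μ] : Continuous (cdf μ) := by
  rw [continuous_iff_continuousAt]
  intro x
  rw [(monotone_cdf μ).continuousAt_iff_leftLim_eq_rightLim, StieltjesFunction.rightLim_eq]
  have h := (cdf μ).measure_singleton x
  rw [measure_cdf, measure_singleton] at h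
  have h1 : cdf μ x - Function.leftLim (cdf μ) x ≤ 0 := ENNReal.ofReal_eq_zero.1 h.symm
  exact le_antisymm ((monotone_cdf μ).leftLim_le le_rfl) (by linarith)

theorem continuous_stdNormalCdf : Continuous (cdf (gaussianReal 0 1)) :=
  have := nullSingletonClass_gaussianReal (μ := 0) (one_ne_zero (α := ℝ≥0))
  continuous_cdf_of_nullSingleton _

theorem strictMono_stdNormalCdf : StrictMono (cdf (gaussianReal 0 1)) := by
  intro x y hxy
  by_contra! hle
  have h := (cdf (gaussianReal 0 1)).measure_Ioc x y
  rw [measure_cdf, ENNReal.ofReal_eq_zero.2 (by linarith)] at h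
  have h2 := gaussianReal_absolutelyContinuous' 0 (one_ne_zero (α := ℝ≥0)) h
  rw [Real.volume_Ioc, ENNReal.ofReal_eq_zero] at h2
  linarith

theorem stdNormalQuantile_cdf (t : ℝ) : stdNormalQuantile (cdf (gaussianReal 0 1) t) = t := by
  have : {x : ℝ | cdf (gaussianReal 0 1) t ≤ cdf (gaussianReal 0 1) x} = Set.Ici t := by
    ext x
    simp [strictMono_stdNormalCdf.le_iff_le]
  rw [stdNormalQuantile, this, csInf_Ici]

theorem stdNormalCdf_pos (t : ℝ) : 0 < cdf (gaussianReal 0 1) t :=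
  (cdf_nonneg _ (t - 1)).trans_lt (strictMono_stdNormalCdf (by linarith))

theorem stdNormalCdf_lt_one (t : ℝ) : cdf (gaussianReal 0 1) t < 1 :=
  (strictMono_stdNormalCdf (by linarith : t < t + 1)).trans_le (cdf_le_one _ _)

theorem cdf_stdNormalQuantile {q : ℝ} (h0 : 0 < q) (h1 : q < 1) :
    cdf (gaussianReal 0 1) (stdNormalQuantile q) = q := by
  obtain ⟨t, rfl⟩ : q ∈ Set.range (cdf (gaussianReal 0 1)) :=
    mem_range_of_exists_le_of_exists_ge continuous_stdNormalCdf
      (((tendsto_cdf_atBot (gaussianReal 0 1)).eventually_le_const h0).exists)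
      (((tendsto_cdf_atTop (gaussianReal 0 1)).eventually_const_le h1).exists)
  rw [stdNormalQuantile_cdf]

theorem gaussianReal_Iio_quantile {q : ℝ} (h0 : 0 < q) (h1 : q < 1) :
    gaussianReal 0 1 (Set.Iio (stdNormalQuantile q)) = ENNReal.ofReal q := by
  have := nullSingletonClass_gaussianReal (μ := 0) (one_ne_zero (α := ℝ≥0))
  rw [measure_congr Iio_ae_eq_Iic, ← ofReal_cdf, cdf_stdNormalQuantile h0 h1]

theorem gaussianReal_Ici_quantile {q : ℝ} (h0 : 0 < q) (h1 : q < 1) :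
    gaussianReal 0 1 (Set.Ici (stdNormalQuantile q)) = ENNReal.ofReal (1 - q) := by
  rw [← Set.compl_Iio, prob_compl_eq_one_sub measurableSet_Iio, gaussianReal_Iio_quantile h0 h1,
    ← ENNReal.ofReal_one, ENNReal.ofReal_sub _ h0.le]

/-! ### Truncated moments of the standard normal distribution -/

theorem stdNormalPdf_eq (x : ℝ) :
    gaussianPDFReal 0 1 x = (Real.sqrt (2 * Real.pi))⁻¹ * Real.exp (-x ^ 2 / 2) := by
  simp [gaussianPDFReal]

theorem stdNormalPdf_pos (x : ℝ) : 0 < gaussianPDFReal 0 1 x :=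
  gaussianPDFReal_pos 0 1 x one_ne_zero

theorem hasDerivAt_stdNormalPdf (x : ℝ) :
    HasDerivAt (gaussianPDFReal 0 1) (-(x * gaussianPDFReal 0 1 x)) x := by
  have h : gaussianPDFReal 0 1 = fun x : ℝ =>
      (Real.sqrt (2 * Real.pi))⁻¹ * Real.exp (-x ^ 2 / 2) := funext stdNormalPdf_eq
  rw [h]
  have h1 : HasDerivAt (fun x : ℝ => -x ^ 2 / 2) (-x) x := by
    have := ((hasDerivAt_pow 2 x).neg).div_const 2
    convert! this using 1
    simp; ring
  convert! (h1.exp.const_mul _) using 1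
  ring

theorem integrable_id_gaussianReal : Integrable (fun x : ℝ => x) (gaussianReal 0 1) :=
  (memLp_id_gaussianReal 1).integrable (by simp)

theorem integrable_sq_gaussianReal : Integrable (fun x : ℝ => x ^ 2) (gaussianReal 0 1) :=
  (memLp_id_gaussianReal 2).integrable_sq

theorem integral_sq_gaussianReal : ∫ x, x ^ 2 ∂(gaussianReal 0 1) = 1 := by
  have h := variance_fun_id_gaussianReal (μ := 0) (v := 1)
  rw [variance_eq_integral measurable_id'.aemeasurable] at h
  simpa [integral_id_gaussianReal] using h

theorem setIntegral_gaussianReal (f : ℝ → ℝ) (s : Set ℝ) (hs : MeasurableSet s) :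
    ∫ x in s, f x ∂(gaussianReal 0 1) = ∫ x in s, gaussianPDFReal 0 1 x * f x := by
  rw [← integral_indicator hs, integral_gaussianReal_eq_integral_smul one_ne_zero,
    ← integral_indicator hs]
  congr 1
  ext x
  by_cases hx : x ∈ s <;> simp [hx]

theorem integrable_pdf_mul {f : ℝ → ℝ} (hf : Integrable f (gaussianReal 0 1)) :
    Integrable (fun x => gaussianPDFReal 0 1 x * f x) := by
  rw [gaussianReal_of_var_ne_zero _ one_ne_zero,
    integrable_withDensity_iff_integrable_smul' (measurable_gaussianPDF 0 1)
      (ae_of_all _ fun x => gaussianPDF_lt_top)] at hf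
  simpa using hf

open Filter Topology in
theorem tendsto_pow_mul_stdNormalPdf (n : ℕ) :
    Tendsto (fun x : ℝ => x ^ n * gaussianPDFReal 0 1 x) atTop (𝓝 0) := by
  have h := (tendsto_rpow_abs_mul_exp_neg_mul_sq_cocompact (a := 1 / 2) (by norm_num) n).mono_left
    atTop_le_cocompact
  have h2 := h.const_mul (Real.sqrt (2 * Real.pi))⁻¹
  rw [mul_zero] at h2
  refine h2.congr' ?_
  filter_upwards [eventually_ge_atTop 0] with x hx
  rw [stdNormalPdf_eq, abs_of_nonneg hx, Real.rpow_natCast]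
  ring_nf

open Filter Topology in
theorem setIntegral_Ici_id_gaussianReal (t : ℝ) :
    ∫ x in Set.Ici t, x ∂(gaussianReal 0 1) = gaussianPDFReal 0 1 t := by
  rw [setIntegral_gaussianReal _ _ measurableSet_Ici, integral_Ici_eq_integral_Ioi]
  have h := integral_Ioi_of_hasDerivAt_of_tendsto' (a := t) (m := 0)
    (f := fun x => - gaussianPDFReal 0 1 x) (f' := fun x => gaussianPDFReal 0 1 x * x)
    (fun x _ => by
      have h := (hasDerivAt_stdNormalPdf x).neg
      rw [neg_neg, mul_comm] at h
      exact h)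
    (integrable_pdf_mul integrable_id_gaussianReal).integrableOn
    (by simpa using (tendsto_pow_mul_stdNormalPdf 0).neg)
  rw [h]; ring

open Filter Topology in
theorem setIntegral_Ici_sq_gaussianReal {q : ℝ} (h0 : 0 < q) (h1 : q < 1) :
    ∫ x in Set.Ici (stdNormalQuantile q), x ^ 2 ∂(gaussianReal 0 1) =
      1 - q + stdNormalQuantile q * gaussianPDFReal 0 1 (stdNormalQuantile q) := by
  set t := stdNormalQuantile q
  rw [setIntegral_gaussianReal _ _ measurableSet_Ici, integral_Ici_eq_integral_Ioi]
  have hi2 := (integrable_pdf_mul integrable_sq_gaussianReal)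
  have hi0 := (integrable_gaussianPDFReal 0 1)
  have h := integral_Ioi_of_hasDerivAt_of_tendsto' (a := t) (m := 0)
    (f := fun x => - (x * gaussianPDFReal 0 1 x))
    (f' := fun x => gaussianPDFReal 0 1 x * x ^ 2 - gaussianPDFReal 0 1 x)
    (fun x _ => by
      convert! ((hasDerivAt_id x).mul (hasDerivAt_stdNormalPdf x)).neg using 1
      simp; ring)
    (hi2.sub hi0).integrableOn
    (by simpa using (tendsto_pow_mul_stdNormalPdf 1).neg)
  rw [integral_sub hi2.integrableOn hi0.integrableOn] at h
  have h3 : ∫ x in Set.Ioi t, gaussianPDFReal 0 1 x = 1 - q := by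
    have h4 := gaussianReal_Ici_quantile h0 h1
    rw [gaussianReal_apply_eq_integral 0 one_ne_zero, integral_Ici_eq_integral_Ioi] at h4
    exact (ENNReal.ofReal_eq_ofReal_iff (integral_nonneg fun x => gaussianPDFReal_nonneg 0 1 x)
      (by linarith)).1 h4
  linarith

theorem setIntegral_Iio_id_gaussianReal (t : ℝ) :
    ∫ x in Set.Iio t, x ∂(gaussianReal 0 1) = - gaussianPDFReal 0 1 t := by
  have h := integral_add_compl (measurableSet_Ici (a := t)) integrable_id_gaussianReal
  rw [Set.compl_Ici, setIntegral_Ici_id_gaussianReal, integral_id_gaussianReal] at h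
  linarith

theorem setIntegral_Iio_sq_gaussianReal {q : ℝ} (h0 : 0 < q) (h1 : q < 1) :
    ∫ x in Set.Iio (stdNormalQuantile q), x ^ 2 ∂(gaussianReal 0 1) =
      q - stdNormalQuantile q * gaussianPDFReal 0 1 (stdNormalQuantile q) := by
  have h := integral_add_compl (measurableSet_Ici (a := stdNormalQuantile q))
    integrable_sq_gaussianReal
  rw [Set.compl_Ici, setIntegral_Ici_sq_gaussianReal h0 h1, integral_sq_gaussianReal] at h
  linarith

/-! ### The law of the radial coin -/

/-- The standardised law of `α`, that is, of `α / σ`. -/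
noncomputable def stdAlphaLaw (p q : ℝ) : Measure ℝ :=
  ENNReal.ofReal p • (gaussianReal 0 1)[|Set.Ici (stdNormalQuantile q)] +
    ENNReal.ofReal (1 - p) • (gaussianReal 0 1)[|Set.Iio (stdNormalQuantile q)]

/-- The standardised mean `E[α] / σ = φ(Φ⁻¹(q)) (p / (1 - q) - (1 - p) / q)` of the radial coin. -/
noncomputable def pugSignal (p q : ℝ) : ℝ :=
  gaussianPDFReal 0 1 (stdNormalQuantile q) * (p / (1 - q) - (1 - p) / q)

theorem pugSigma_pos {d : ℕ} (hd : 1 ≤ d) : 0 < pugSigma d :=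
  Real.sqrt_pos.2 (by positivity)

theorem pugM_eq {d : ℕ} (hd : 1 ≤ d) (p q : ℝ) : pugM d p q = pugSigma d * pugSignal p q := by
  rw [pugM, pugSignal, pugGamma, mul_div_cancel_left₀ _ (pugSigma_pos hd).ne', mul_assoc]

theorem cond_map {Ω Ω' : Type*} [MeasurableSpace Ω] [MeasurableSpace Ω'] (μ : Measure Ω)
    {f : Ω → Ω'} (hf : Measurable f) {s : Set Ω'} (hs : MeasurableSet s) :
    (μ.map f)[|s] = (μ[|f ⁻¹' s]).map f := by
  rw [ProbabilityTheory.cond, ProbabilityTheory.cond, Measure.map_apply hf hs,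
    Measure.restrict_map hf hs, Measure.map_smul]

/-- In every dimension the law of `α` is the standardised law, scaled by `σ`. -/
theorem pugAlphaLaw_eq_map {d : ℕ} (hd : 1 ≤ d) (p q : ℝ) :
    pugAlphaLaw d p q = (stdAlphaLaw p q).map (pugSigma d * ·) := by
  have hσ := pugSigma_pos hd
  have hN : gaussianReal 0 (1 / d) = (gaussianReal 0 1).map (pugSigma d * ·) := by
    rw [gaussianReal_map_const_mul, mul_zero]
    congr 1
    ext
    simp [pugSigma]
  have hm : Measurable (pugSigma d * ·) := measurable_const_mul _
  rw [pugAlphaLaw, stdAlphaLaw, hN, cond_map _ hm measurableSet_Ici,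
    cond_map _ hm measurableSet_Iio, Measure.map_add _ _ hm, Measure.map_smul, Measure.map_smul]
  congr 4 <;> ext x <;> simp [pugGamma, hσ, mul_div_cancel_left₀ _ hσ.ne']

theorem stdAlphaLaw_eq {p q : ℝ} (hp0 : 0 ≤ p) (hp1 : p ≤ 1) (hq0 : 0 < q) (hq1 : q < 1) :
    stdAlphaLaw p q =
      ENNReal.ofReal (p / (1 - q)) •
          (gaussianReal 0 1).restrict (Set.Ici (stdNormalQuantile q)) +
        ENNReal.ofReal ((1 - p) / q) •
          (gaussianReal 0 1).restrict (Set.Iio (stdNormalQuantile q)) := by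
  rw [stdAlphaLaw, ProbabilityTheory.cond, ProbabilityTheory.cond,
    gaussianReal_Ici_quantile hq0 hq1, gaussianReal_Iio_quantile hq0 hq1,
    smul_smul, smul_smul, div_eq_mul_inv, div_eq_mul_inv, ENNReal.ofReal_mul hp0,
    ENNReal.ofReal_mul (by linarith), ENNReal.ofReal_inv_of_pos hq0,
    ENNReal.ofReal_inv_of_pos (by linarith : 0 < 1 - q)]

theorem isProbabilityMeasure_stdAlphaLaw {p q : ℝ} (hp0 : 0 ≤ p) (hp1 : p ≤ 1) (hq0 : 0 < q)
    (hq1 : q < 1) : IsProbabilityMeasure (stdAlphaLaw p q) := by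
  constructor
  rw [stdAlphaLaw_eq hp0 hp1 hq0 hq1]
  simp only [Measure.coe_add, Measure.coe_smul, Pi.add_apply, Pi.smul_apply,
    Measure.restrict_apply_univ, smul_eq_mul]
  rw [gaussianReal_Ici_quantile hq0 hq1, gaussianReal_Iio_quantile hq0 hq1,
    ← ENNReal.ofReal_mul (div_nonneg hp0 (by linarith)),
    ← ENNReal.ofReal_mul (div_nonneg (by linarith) hq0.le), ← ENNReal.ofReal_add,
    div_mul_cancel₀ _ (by linarith), div_mul_cancel₀ _ hq0.ne']
  · simp
  · rw [div_mul_cancel₀ _ (by linarith)]; exact hp0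
  · rw [div_mul_cancel₀ _ hq0.ne']; linarith

/-- The density of the radial coin with respect to the normal law is at most its value on the
cap. -/
theorem stdAlphaLaw_le {p q : ℝ} (hp0 : 0 ≤ p) (hp1 : p ≤ 1) (hq0 : 0 < q) (hq1 : q < 1)
    (h : (1 - p) / q ≤ p / (1 - q)) :
    stdAlphaLaw p q ≤ ENNReal.ofReal (p / (1 - q)) • gaussianReal 0 1 := by
  rw [stdAlphaLaw_eq hp0 hp1 hq0 hq1]
  conv_rhs => rw [← Measure.restrict_add_restrict_compl (μ := gaussianReal 0 1)
    (measurableSet_Ici (a := stdNormalQuantile q)), Set.compl_Ici, smul_add]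
  gcongr

/-- The density of the radial coin with respect to the normal law is at least its value off the
cap. -/
theorem le_stdAlphaLaw {p q : ℝ} (hp0 : 0 ≤ p) (hp1 : p ≤ 1) (hq0 : 0 < q) (hq1 : q < 1)
    (h : (1 - p) / q ≤ p / (1 - q)) :
    ENNReal.ofReal ((1 - p) / q) • gaussianReal 0 1 ≤ stdAlphaLaw p q := by
  rw [stdAlphaLaw_eq hp0 hp1 hq0 hq1]
  conv_lhs => rw [← Measure.restrict_add_restrict_compl (μ := gaussianReal 0 1)
    (measurableSet_Ici (a := stdNormalQuantile q)), Set.compl_Ici, smul_add]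
  gcongr

theorem integrable_stdAlphaLaw {p q : ℝ} (hp0 : 0 ≤ p) (hp1 : p ≤ 1) (hq0 : 0 < q) (hq1 : q < 1)
    {f : ℝ → ℝ} (hf : Integrable f (gaussianReal 0 1)) : Integrable f (stdAlphaLaw p q) := by
  rw [stdAlphaLaw_eq hp0 hp1 hq0 hq1]
  exact (hf.restrict.smul_measure ENNReal.ofReal_ne_top).add_measure
    (hf.restrict.smul_measure ENNReal.ofReal_ne_top)

theorem integral_stdAlphaLaw {p q : ℝ} (hp0 : 0 ≤ p) (hp1 : p ≤ 1) (hq0 : 0 < q) (hq1 : q < 1)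
    {f : ℝ → ℝ} (hf : Integrable f (gaussianReal 0 1)) :
    ∫ x, f x ∂(stdAlphaLaw p q) =
      p / (1 - q) * ∫ x in Set.Ici (stdNormalQuantile q), f x ∂(gaussianReal 0 1) +
        (1 - p) / q * ∫ x in Set.Iio (stdNormalQuantile q), f x ∂(gaussianReal 0 1) := by
  rw [stdAlphaLaw_eq hp0 hp1 hq0 hq1, integral_add_measure
    (hf.restrict.smul_measure ENNReal.ofReal_ne_top)
    (hf.restrict.smul_measure ENNReal.ofReal_ne_top), integral_smul_measure, integral_smul_measure,
    ENNReal.toReal_ofReal (div_nonneg hp0 (by linarith)),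
    ENNReal.toReal_ofReal (div_nonneg (by linarith) hq0.le), smul_eq_mul, smul_eq_mul]

theorem integral_id_stdAlphaLaw {p q : ℝ} (hp0 : 0 ≤ p) (hp1 : p ≤ 1) (hq0 : 0 < q) (hq1 : q < 1) :
    ∫ x, x ∂(stdAlphaLaw p q) = pugSignal p q := by
  rw [integral_stdAlphaLaw hp0 hp1 hq0 hq1 integrable_id_gaussianReal,
    setIntegral_Ici_id_gaussianReal, setIntegral_Iio_id_gaussianReal, pugSignal]
  ring

theorem integral_sq_stdAlphaLaw {p q : ℝ} (hp0 : 0 ≤ p) (hp1 : p ≤ 1) (hq0 : 0 < q) (hq1 : q < 1) :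
    ∫ x, x ^ 2 ∂(stdAlphaLaw p q) = 1 + stdNormalQuantile q * pugSignal p q := by
  rw [integral_stdAlphaLaw hp0 hp1 hq0 hq1 integrable_sq_gaussianReal,
    setIntegral_Ici_sq_gaussianReal hq0 hq1, setIntegral_Iio_sq_gaussianReal hq0 hq1, pugSignal]
  have : 1 - q ≠ 0 := by linarith
  field_simp
  ring

/-- The variance of the radial coin is nonnegative. -/
theorem pugSignal_sq_le {p q : ℝ} (hp0 : 0 ≤ p) (hp1 : p ≤ 1) (hq0 : 0 < q) (hq1 : q < 1) :
    pugSignal p q ^ 2 ≤ 1 + stdNormalQuantile q * pugSignal p q := by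
  have := isProbabilityMeasure_stdAlphaLaw hp0 hp1 hq0 hq1
  have hi1 := integrable_stdAlphaLaw hp0 hp1 hq0 hq1 integrable_id_gaussianReal
  have hi2 := integrable_stdAlphaLaw hp0 hp1 hq0 hq1 integrable_sq_gaussianReal
  have h : 0 ≤ ∫ x, (x ^ 2 - 2 * pugSignal p q * x + pugSignal p q ^ 2) ∂(stdAlphaLaw p q) :=
    integral_nonneg fun x => by
      change 0 ≤ x ^ 2 - 2 * pugSignal p q * x + pugSignal p q ^ 2
      nlinarith [sq_nonneg (x - pugSignal p q)]
  have hi3 : Integrable (fun x => x ^ 2 - 2 * pugSignal p q * x) (stdAlphaLaw p q) :=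
    hi2.sub (hi1.const_mul _)
  rw [integral_add hi3 (integrable_const _),
    integral_sub hi2 (hi1.const_mul _), integral_const_mul, integral_id_stdAlphaLaw hp0 hp1 hq0 hq1,
    integral_sq_stdAlphaLaw hp0 hp1 hq0 hq1, integral_const] at h
  simp at h
  nlinarith

/-! ### Recombining a radial and a transversal part -/

/-- The vector `x v + (g - ⟨v, g⟩ v)` whose component along the unit vector `v` is `x` and whose
component orthogonal to `v` is that of `g`. -/
noncomputable def recombine {d : ℕ} (v : Euc d) (ω : ℝ × Euc d) : Euc d :=
  ω.1 • v + (ω.2 - (inner ℝ v ω.2) • v)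

theorem continuous_recombine {d : ℕ} (v : Euc d) : Continuous (recombine v) := by
  unfold recombine; fun_prop

theorem continuous_smul_recombine {d : ℕ} (r : ℝ) (v : Euc d) :
    Continuous fun ω => r • recombine v ω :=
  (continuous_recombine v).const_smul r

theorem pugOutput_scale {d : ℕ} (hd : 1 ≤ d) (p q : ℝ) (v : Euc d) (ω : ℝ × Euc d) :
    pugOutput p q v (Prod.map (pugSigma d * ·) id ω) = (pugSignal p q)⁻¹ • recombine v ω := by
  have hσ := (pugSigma_pos hd).ne'
  simp only [pugOutput, Prod.map, id, recombine, mul_smul, ← smul_add]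
  rw [smul_smul, pugM_eq hd]
  congr 1
  rw [one_div, mul_inv]
  field_simp

theorem pugCoins_eq_map {d : ℕ} (hd : 1 ≤ d) {p q : ℝ} (hp0 : 0 ≤ p) (hp1 : p ≤ 1) (hq0 : 0 < q)
    (hq1 : q < 1) :
    pugCoins d p q = ((stdAlphaLaw p q).prod (stdGaussian (Euc d))).map
      (Prod.map (pugSigma d * ·) id) := by
  have := isProbabilityMeasure_stdAlphaLaw hp0 hp1 hq0 hq1
  rw [← Measure.map_prod_map _ _ (measurable_const_mul _) measurable_id, Measure.map_id, pugCoins,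
    pugAlphaLaw_eq_map hd]

theorem pug_eq_map {d : ℕ} (hd : 1 ≤ d) {p q : ℝ} (hp0 : 0 ≤ p) (hp1 : p ≤ 1) (hq0 : 0 < q)
    (hq1 : q < 1) (v : Euc d) :
    pug d p q v = ((stdAlphaLaw p q).prod (stdGaussian (Euc d))).map
      (fun ω => (pugSignal p q)⁻¹ • recombine v ω) := by
  have hm : Measurable (Prod.map (pugSigma d * ·) (id : Euc d → Euc d)) :=
    (measurable_const_mul _).prodMap measurable_id
  have hm2 : Measurable (pugOutput (d := d) p q v) := by unfold pugOutput; fun_prop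
  rw [pug, pugCoins_eq_map hd hp0 hp1 hq0 hq1, Measure.map_map hm2 hm]
  congr 1
  ext1 ω
  exact pugOutput_scale hd p q v ω

/-- A standard Gaussian vector has independent components along `v` and orthogonal to it. -/
theorem map_recombine_gaussian {d : ℕ} {v : Euc d} (hv : ‖v‖ = 1) :
    ((gaussianReal 0 1).prod (stdGaussian (Euc d))).map (recombine v) = stdGaussian (Euc d) := by
  have := Measure.isProbabilityMeasure_map (μ := (gaussianReal 0 1).prod (stdGaussian (Euc d)))
    (continuous_recombine v).aemeasurable
  apply Measure.ext_of_charFun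
  ext t
  rw [charFun_stdGaussian, charFun_apply, integral_map (continuous_recombine v).aemeasurable
    (by fun_prop)]
  have h : ∀ ω : ℝ × Euc d, Complex.exp (inner ℝ (recombine v ω) t * Complex.I) =
      Complex.exp (inner ℝ ω.1 (inner ℝ v t) * Complex.I) *
        Complex.exp (inner ℝ ω.2 (t - inner ℝ v t • v) * Complex.I) := by
    intro ω
    rw [← Complex.exp_add, ← add_mul, ← Complex.ofReal_add]
    congr 4
    simp only [recombine, inner_add_left, inner_sub_left, inner_smul_left, inner_sub_right,
      inner_smul_right, real_inner_comm v]
    simp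
    ring
  simp_rw [h]
  rw [integral_prod_mul (fun x : ℝ => Complex.exp (inner ℝ x (inner ℝ v t) * Complex.I))
    (fun g : Euc d => Complex.exp (inner ℝ g (t - inner ℝ v t • v) * Complex.I)),
    ← charFun_apply, ← charFun_apply, charFun_stdGaussian, charFun_gaussianReal, ← Complex.exp_add]
  congr 1
  have h2 : ‖t - inner ℝ v t • v‖ ^ 2 = ‖t‖ ^ 2 - inner ℝ v t ^ 2 := by
    rw [norm_sub_sq_real, inner_smul_right, norm_smul, hv, real_inner_comm v t]
    simp; ring
  rw [← Complex.ofReal_pow ‖t - _‖, h2]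
  push_cast
  ring

/-! ### Privacy of PrivUnitG -/

theorem PugAdmissible.lt_div {ε p q : ℝ} (h : PugAdmissible ε p q) : (1 - p) / q < p / (1 - q) := by
  obtain ⟨hp0, hp1, hq0, hq1, hpq, -⟩ := h
  have h1 : (1 - p) / q < 1 := by rw [div_lt_one hq0]; linarith
  have h2 : 1 < p / (1 - q) := by rw [one_lt_div (by linarith)]; linarith
  linarith

theorem PugAdmissible.pugSignal_pos {ε p q : ℝ} (h : PugAdmissible ε p q) : 0 < pugSignal p q :=
  mul_pos (stdNormalPdf_pos _) (sub_pos.2 h.lt_div)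

/-- PrivUnitG is private: its law has density between `(1 - p) / q` and `p / (1 - q)` with respect
to a Gaussian that does not depend on the input. -/
theorem isLocallyDP_pug {ε : ℝ} {d : ℕ} (hd : 1 ≤ d) {p q : ℝ} (h : PugAdmissible ε p q) :
    IsLocallyDP ε (pug d p q) := by
  intro v w hv hw S hS
  have hlt := h.lt_div
  obtain ⟨hp0, hp1, hq0, hq1, hpq, hε⟩ := h
  have := isProbabilityMeasure_stdAlphaLaw hp0.le hp1.le hq0 hq1
  set r := (pugSignal p q)⁻¹
  set G := stdGaussian (Euc d)
  have hmeas : ∀ u : Euc d, Measurable (fun ω => r • recombine u ω) := fun u =>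
    (continuous_smul_recombine r u).measurable
  have key : ∀ u : Euc d, ‖u‖ = 1 →
      ((gaussianReal 0 1).prod G) ((fun ω => r • recombine u ω) ⁻¹' S) = G ((r • ·) ⁻¹' S) := by
    intro u hu
    have hG : ((gaussianReal 0 1).prod G).map (recombine u) = G := map_recombine_gaussian hu
    conv_rhs => rw [← hG, Measure.map_apply (continuous_recombine u).measurable
      (measurable_const_smul r hS)]
    rfl
  rw [pug_eq_map hd hp0.le hp1.le hq0 hq1, pug_eq_map hd hp0.le hp1.le hq0 hq1,
    Measure.map_apply (hmeas v) hS, Measure.map_apply (hmeas w) hS]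
  calc ((stdAlphaLaw p q).prod G) ((fun ω => r • recombine v ω) ⁻¹' S)
      ≤ ((ENNReal.ofReal (p / (1 - q)) • gaussianReal 0 1).prod G)
          ((fun ω => r • recombine v ω) ⁻¹' S) :=
        Measure.prod_mono (stdAlphaLaw_le hp0.le hp1.le hq0 hq1 hlt.le) le_rfl _
    _ = ENNReal.ofReal (p / (1 - q)) * G ((r • ·) ⁻¹' S) := by
        rw [Measure.prod_smul_left, Measure.smul_apply, smul_eq_mul, key v hv]
    _ ≤ ENNReal.ofReal (Real.exp ε) * (ENNReal.ofReal ((1 - p) / q) * G ((r • ·) ⁻¹' S)) := by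
        rw [← mul_assoc, ← ENNReal.ofReal_mul (Real.exp_pos ε).le]
        gcongr
    _ = ENNReal.ofReal (Real.exp ε) * ((ENNReal.ofReal ((1 - p) / q) • gaussianReal 0 1).prod G)
          ((fun ω => r • recombine w ω) ⁻¹' S) := by
        rw [Measure.prod_smul_left, Measure.smul_apply, smul_eq_mul, key w hw]
    _ ≤ _ := by
        gcongr
        exact le_stdAlphaLaw hp0.le hp1.le hq0 hq1 hlt.le

/-! ### Moments of PrivUnitG -/

theorem integral_inner_sq_stdGaussian {d : ℕ} (v : Euc d) :
    ∫ g, (inner ℝ v g : ℝ) ^ 2 ∂(stdGaussian (Euc d)) = ‖v‖ ^ 2 := by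
  have h := variance_dual_stdGaussian (innerSL ℝ v)
  rw [variance_eq_integral (by fun_prop), integral_strongDual_stdGaussian, innerSL_apply_norm] at h
  simpa using h

theorem memLp_inner_stdGaussian {d : ℕ} (v : Euc d) :
    MemLp (fun g : Euc d => (inner ℝ v g : ℝ)) 2 (stdGaussian (Euc d)) :=
  (innerSL ℝ v).comp_memLp' IsGaussian.memLp_two_id

theorem integral_norm_sq_stdGaussian (d : ℕ) :
    ∫ g, ‖g‖ ^ 2 ∂(stdGaussian (Euc d)) = d := by
  have h : ∀ g : Euc d, ‖g‖ ^ 2 = ∑ i, (inner ℝ (EuclideanSpace.single i (1 : ℝ)) g : ℝ) ^ 2 := by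
    intro g
    simp [EuclideanSpace.real_norm_sq_eq, EuclideanSpace.inner_single_left]
  simp_rw [h]
  rw [integral_finsetSum _ fun i _ => (memLp_inner_stdGaussian _).integrable_sq]
  simp [integral_inner_sq_stdGaussian]

theorem norm_sq_recombine {d : ℕ} {v : Euc d} (hv : ‖v‖ = 1) (ω : ℝ × Euc d) :
    ‖recombine v ω‖ ^ 2 = ω.1 ^ 2 + (‖ω.2‖ ^ 2 - (inner ℝ v ω.2 : ℝ) ^ 2) := by
  rw [recombine, norm_add_sq_real, norm_sub_sq_real, inner_sub_right, inner_smul_left,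
    inner_smul_right, inner_smul_left, inner_smul_right, real_inner_self_eq_norm_sq, hv,
    norm_smul, norm_smul, hv, real_inner_comm v ω.2]
  simp
  ring

theorem norm_recombine_le {d : ℕ} {v : Euc d} (hv : ‖v‖ ≤ 1) (ω : ℝ × Euc d) :
    ‖recombine v ω‖ ≤ |ω.1| + 2 * ‖ω.2‖ := by
  have h1 : |(inner ℝ v ω.2 : ℝ)| ≤ ‖ω.2‖ :=
    (abs_real_inner_le_norm v ω.2).trans (mul_le_of_le_one_left (norm_nonneg _) hv)
  calc ‖recombine v ω‖ ≤ ‖ω.1 • v‖ + (‖ω.2‖ + ‖(inner ℝ v ω.2 : ℝ) • v‖) :=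
        (norm_add_le _ _).trans (by gcongr; exact norm_sub_le _ _)
    _ ≤ |ω.1| + (‖ω.2‖ + ‖ω.2‖) := by
        rw [norm_smul, norm_smul, Real.norm_eq_abs, Real.norm_eq_abs]
        gcongr
        · exact mul_le_of_le_one_right (abs_nonneg _) hv
        · exact (mul_le_of_le_one_right (abs_nonneg _) hv).trans h1
    _ = _ := by ring

section
variable {p q : ℝ}

theorem memLp_recombineBound (d : ℕ) (hp0 : 0 ≤ p) (hp1 : p ≤ 1) (hq0 : 0 < q) (hq1 : q < 1) :
    MemLp (fun ω : ℝ × Euc d => |ω.1| + 2 * ‖ω.2‖) 2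
      ((stdAlphaLaw p q).prod (stdGaussian (Euc d))) := by
  have := isProbabilityMeasure_stdAlphaLaw hp0 hp1 hq0 hq1
  have h1 : MemLp (fun x : ℝ => x) 2 (stdAlphaLaw p q) := by
    rw [memLp_two_iff_integrable_sq (by fun_prop)]
    exact integrable_stdAlphaLaw hp0 hp1 hq0 hq1 integrable_sq_gaussianReal
  have h2 : MemLp (fun g : Euc d => g) 2 (stdGaussian (Euc d)) := IsGaussian.memLp_two_id
  exact (h1.abs.comp_fst _).add ((h2.norm.comp_snd _).const_mul 2)

theorem memLp_recombine {d : ℕ} (hp0 : 0 ≤ p) (hp1 : p ≤ 1) (hq0 : 0 < q) (hq1 : q < 1)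
    {v : Euc d} (hv : ‖v‖ ≤ 1) :
    MemLp (recombine v) 2 ((stdAlphaLaw p q).prod (stdGaussian (Euc d))) :=
  (memLp_recombineBound d hp0 hp1 hq0 hq1).mono' (continuous_recombine v).aestronglyMeasurable
    (ae_of_all _ fun ω => norm_recombine_le hv ω)

theorem integral_recombine {d : ℕ} (hp0 : 0 ≤ p) (hp1 : p ≤ 1) (hq0 : 0 < q) (hq1 : q < 1)
    (v : Euc d) :
    ∫ ω, recombine v ω ∂((stdAlphaLaw p q).prod (stdGaussian (Euc d))) = pugSignal p q • v := by
  have := isProbabilityMeasure_stdAlphaLaw hp0 hp1 hq0 hq1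
  have hx : Integrable (fun x : ℝ => x • v) (stdAlphaLaw p q) :=
    (integrable_stdAlphaLaw hp0 hp1 hq0 hq1 integrable_id_gaussianReal).smul_const v
  have hg : Integrable (fun g : Euc d => g) (stdGaussian (Euc d)) := IsGaussian.integrable_id
  have hi : Integrable (fun g : Euc d => (inner ℝ v g : ℝ) • v) (stdGaussian (Euc d)) :=
    ((memLp_inner_stdGaussian v).integrable (by norm_num)).smul_const v
  have h0 : ∫ g, (inner ℝ v g : ℝ) ∂(stdGaussian (Euc d)) = 0 :=
    integral_strongDual_stdGaussian (innerSL ℝ v)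
  have e : ∫ g, (g - (inner ℝ v g : ℝ) • v) ∂(stdGaussian (Euc d)) = 0 := by
    rw [integral_sub hg hi, integral_id_stdGaussian, integral_smul_const, h0]
    simp
  have key : ∫ ω, recombine v ω ∂((stdAlphaLaw p q).prod (stdGaussian (Euc d))) =
      ∫ ω, ω.1 • v ∂((stdAlphaLaw p q).prod (stdGaussian (Euc d))) +
        ∫ ω, (ω.2 - (inner ℝ v ω.2 : ℝ) • v) ∂((stdAlphaLaw p q).prod (stdGaussian (Euc d))) :=
    integral_add (hx.comp_fst _) ((hg.sub hi).comp_snd _)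
  rw [key, integral_fun_fst (fun x : ℝ => x • v),
    integral_fun_snd (fun g : Euc d => g - (inner ℝ v g : ℝ) • v), e, integral_smul_const,
    integral_id_stdAlphaLaw hp0 hp1 hq0 hq1]
  simp

theorem integral_norm_sq_recombine {d : ℕ} (hp0 : 0 ≤ p) (hp1 : p ≤ 1) (hq0 : 0 < q) (hq1 : q < 1)
    {v : Euc d} (hv : ‖v‖ = 1) :
    ∫ ω, ‖recombine v ω‖ ^ 2 ∂((stdAlphaLaw p q).prod (stdGaussian (Euc d))) =
      d + stdNormalQuantile q * pugSignal p q := by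
  have := isProbabilityMeasure_stdAlphaLaw hp0 hp1 hq0 hq1
  have hx : Integrable (fun x : ℝ => x ^ 2) (stdAlphaLaw p q) :=
    integrable_stdAlphaLaw hp0 hp1 hq0 hq1 integrable_sq_gaussianReal
  have hg : Integrable (fun g : Euc d => ‖g‖ ^ 2) (stdGaussian (Euc d)) :=
    (IsGaussian.memLp_two_id (μ := stdGaussian (Euc d))).integrable_norm_pow (by norm_num)
  have hi := (memLp_inner_stdGaussian v).integrable_sq
  have hgi : Integrable (fun g : Euc d => ‖g‖ ^ 2 - (inner ℝ v g : ℝ) ^ 2) (stdGaussian (Euc d)) :=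
    hg.sub hi
  simp_rw [norm_sq_recombine hv]
  rw [integral_add (hx.comp_fst _) (hgi.comp_snd _), integral_fun_fst (fun x : ℝ => x ^ 2),
    integral_fun_snd (fun g : Euc d => ‖g‖ ^ 2 - (inner ℝ v g : ℝ) ^ 2), integral_sub hg hi,
    integral_norm_sq_stdGaussian, integral_inner_sq_stdGaussian, hv,
    integral_sq_stdAlphaLaw hp0 hp1 hq0 hq1]
  simp
  ring

end

/-- `E ‖PrivUnitG(v)‖²` for a unit vector `v`. -/
noncomputable def pugSecondMoment (d : ℕ) (p q : ℝ) : ℝ :=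
  d / pugSignal p q ^ 2 + stdNormalQuantile q / pugSignal p q

theorem integral_norm_sq_smul_recombine {d : ℕ} {ε p q : ℝ} (h : PugAdmissible ε p q)
    {v : Euc d} (hv : ‖v‖ = 1) (c : ℝ) :
    ∫ ω, ‖c • (pugSignal p q)⁻¹ • recombine v ω‖ ^ 2
      ∂((stdAlphaLaw p q).prod (stdGaussian (Euc d))) = c ^ 2 * pugSecondMoment d p q := by
  have hs := h.pugSignal_pos
  obtain ⟨hp0, hp1, hq0, hq1, -, -⟩ := h
  simp_rw [norm_smul, mul_pow]
  rw [integral_const_mul, integral_const_mul, integral_norm_sq_recombine hp0.le hp1.le hq0 hq1 hv,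
    pugSecondMoment]
  simp only [Real.norm_eq_abs, sq_abs]
  field_simp

/-! ### The error of averaging protocols -/

theorem integral_norm_sq_meanVec_sub {M : Type*} [MeasurableSpace M] {n d : ℕ}
    (μ : Fin n → Measure M) [∀ i, IsProbabilityMeasure (μ i)] {f : M → Euc d}
    (hL : ∀ i, MemLp f 2 (μ i)) {v : Fin n → Euc d} (hv : ∀ i, ∫ m, f m ∂(μ i) = v i) :
    ∫ m, ‖meanVec (fun i => f (m i)) - meanVec v‖ ^ 2 ∂(Measure.pi μ) =
      ((n : ℝ) ^ 2)⁻¹ * ∑ i, (∫ m, ‖f m‖ ^ 2 ∂(μ i) - ‖v i‖ ^ 2) := by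
  have hLc : ∀ i c, MemLp (fun m => f m c) 2 (μ i) := fun i c => (hL i).eval_piLp c
  have hI : ∀ i c, Integrable (fun m => f m c) (μ i) := fun i c =>
    (hLc i c).integrable (by norm_num)
  have hvc : ∀ i c, ∫ m, f m c ∂(μ i) = v i c := fun i c => by
    rw [← hv i, eval_integral_piLp (fun c => hI i c)]
  have hLp : ∀ i c, MemLp (fun m : Fin n → M => f (m i) c) 2 (Measure.pi μ) := fun i c =>
    (hLc i c).comp_measurePreserving (measurePreserving_eval μ i)
  -- coordinatewise, the error is the variance of a sum of independent variables
  have hvar : ∀ c, ∫ m, (∑ i, f (m i) c - ∑ i, v i c) ^ 2 ∂(Measure.pi μ) =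
      ∑ i, (∫ m, f m c ^ 2 ∂(μ i) - v i c ^ 2) := by
    intro c
    have h1 := variance_sum_pi (μ := μ) (X := fun i m => f m c) (fun i => hLc i c)
    have hL' : MemLp (∑ i, fun m : Fin n → M => f (m i) c) 2 (Measure.pi μ) :=
      memLp_finsetSum' _ fun i _ => hLp i c
    have hE : ∫ m : Fin n → M, (∑ i, fun m : Fin n → M => f (m i) c) m ∂(Measure.pi μ) =
        ∑ i, v i c := by
      simp only [Finset.sum_apply]
      rw [integral_finsetSum _ fun i _ => (hLp i c).integrable (by norm_num)]
      exact Finset.sum_congr rfl fun i _ =>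
        (integral_comp_eval (μ := μ) (f := fun m => f m c)
          (hI i c).aestronglyMeasurable).trans (hvc i c)
    rw [variance_eq_integral hL'.aestronglyMeasurable.aemeasurable, hE] at h1
    simp only [Finset.sum_apply] at h1
    rw [h1]
    exact Finset.sum_congr rfl fun i _ => by
      rw [variance_eq_sub (hLc i c)]
      simp [hvc]
  have hnorm : ∀ m : Fin n → M, ‖meanVec (fun i => f (m i)) - meanVec v‖ ^ 2 =
      ((n : ℝ) ^ 2)⁻¹ * ∑ c, (∑ i, f (m i) c - ∑ i, v i c) ^ 2 := by
    intro m
    rw [meanVec, meanVec, ← smul_sub, norm_smul, mul_pow, EuclideanSpace.real_norm_sq_eq]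
    simp
  simp_rw [hnorm]
  rw [integral_const_mul, integral_finsetSum]
  · simp_rw [hvar]
    rw [Finset.sum_comm]
    congr 1
    refine Finset.sum_congr rfl fun i _ => ?_
    simp_rw [EuclideanSpace.real_norm_sq_eq]
    rw [integral_finsetSum _ fun c _ => (hLc i c).integrable_sq, Finset.sum_sub_distrib]
  · intro c _
    exact ((memLp_finsetSum _ fun i _ => hLp i c).sub (memLp_const _)).integrable_sq

/-- Independent unbiased messages whose second moment is `F` have mean squared error
`(F - 1) / n`. -/
theorem lintegral_meanVec_sub_eq {M : Type*} [MeasurableSpace M] {n d : ℕ} (hn : 1 ≤ n)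
    (μ : Fin n → Measure M) [∀ i, IsProbabilityMeasure (μ i)] {f : M → Euc d}
    (hL : ∀ i, MemLp f 2 (μ i)) {v : Fin n → Euc d} (hv : ∀ i, ∫ m, f m ∂(μ i) = v i)
    (hv1 : ∀ i, ‖v i‖ = 1) {F : ℝ} (hF : ∀ i, ∫ m, ‖f m‖ ^ 2 ∂(μ i) = F) :
    ∫⁻ m, ‖meanVec (fun i => f (m i)) - meanVec v‖ₑ ^ 2 ∂(Measure.pi μ) =
      ENNReal.ofReal ((F - 1) / n) := by
  have h := integral_norm_sq_meanVec_sub μ hL hv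
  have hmem : MemLp (fun m : Fin n → M => meanVec (fun i => f (m i)) - meanVec v) 2
      (Measure.pi μ) := by
    have h1 : ∀ i, MemLp (fun m : Fin n → M => f (m i)) 2 (Measure.pi μ) := fun i =>
      (hL i).comp_measurePreserving (measurePreserving_eval μ i)
    have h2 : MemLp (fun m : Fin n → M => ∑ i, f (m i)) 2 (Measure.pi μ) :=
      memLp_finsetSum _ fun i _ => h1 i
    exact (h2.const_smul (n : ℝ)⁻¹).sub (memLp_const (meanVec v))
  have hint : Integrable (fun m : Fin n → M => ‖meanVec (fun i => f (m i)) - meanVec v‖ ^ 2)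
      (Measure.pi μ) := hmem.integrable_norm_pow (by norm_num)
  have hpt : ∀ m : Fin n → M, ‖meanVec (fun i => f (m i)) - meanVec v‖ₑ ^ 2 =
      ENNReal.ofReal (‖meanVec (fun i => f (m i)) - meanVec v‖ ^ 2) := fun m => by
    rw [ENNReal.ofReal_pow (norm_nonneg _), ofReal_norm]
  simp_rw [hpt]
  rw [← ofReal_integral_eq_lintegral_ofReal hint (ae_of_all _ fun m => sq_nonneg _), h]
  congr 1
  have hn0 : (n : ℝ) ≠ 0 := by positivity
  simp only [hF, hv1, one_pow, Finset.sum_const, Finset.card_univ, Fintype.card_fin, nsmul_eq_mul]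
  field_simp

theorem isProbabilityMeasure_pug {d : ℕ} (hd : 1 ≤ d) {ε p q : ℝ} (h : PugAdmissible ε p q)
    (v : Euc d) : IsProbabilityMeasure (pug d p q v) := by
  obtain ⟨hp0, hp1, hq0, hq1, -, -⟩ := h
  have := isProbabilityMeasure_stdAlphaLaw hp0.le hp1.le hq0 hq1
  rw [pug_eq_map hd hp0.le hp1.le hq0 hq1]
  exact Measure.isProbabilityMeasure_map (continuous_smul_recombine _ v).aemeasurable

theorem pugErr_eq {n d : ℕ} (hn : 1 ≤ n) (hd : 1 ≤ d) {ε p q : ℝ} (h : PugAdmissible ε p q) :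
    pugErr n d p q = ENNReal.ofReal ((pugSecondMoment d p q - 1) / n) := by
  have key : ∀ v : Fin n → Metric.sphere (0 : Euc d) 1,
      protocolMSE meanVec (pug d p q) (fun i => (v i : Euc d)) =
        ENNReal.ofReal ((pugSecondMoment d p q - 1) / n) := by
    intro v
    have hv : ∀ i, ‖(v i : Euc d)‖ = 1 := fun i => by simp
    have := fun i => isProbabilityMeasure_pug hd h (v i : Euc d)
    have hs := h.pugSignal_pos
    have h' := h
    obtain ⟨hp0, hp1, hq0, hq1, -, -⟩ := h
    have := isProbabilityMeasure_stdAlphaLaw hp0.le hp1.le hq0 hq1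
    have hm : ∀ i, AEMeasurable (fun ω => (pugSignal p q)⁻¹ • recombine (v i : Euc d) ω)
        ((stdAlphaLaw p q).prod (stdGaussian (Euc d))) := fun i =>
      (continuous_smul_recombine _ _).aemeasurable
    refine lintegral_meanVec_sub_eq hn (fun i => pug d p q (v i : Euc d)) (f := fun x => x)
      (fun i => ?_) (fun i => ?_) hv (fun i => ?_)
    · rw [pug_eq_map hd hp0.le hp1.le hq0 hq1, memLp_map_measure_iff (by fun_prop) (hm i)]
      exact (memLp_recombine hp0.le hp1.le hq0 hq1 (hv i).le).const_smul (pugSignal p q)⁻¹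
    · rw [pug_eq_map hd hp0.le hp1.le hq0 hq1, integral_map (hm i) (by fun_prop), integral_smul,
        integral_recombine hp0.le hp1.le hq0 hq1, smul_smul, inv_mul_cancel₀ hs.ne', one_smul]
    · rw [pug_eq_map hd hp0.le hp1.le hq0 hq1, integral_map (hm i) (by fun_prop)]
      simpa using integral_norm_sq_smul_recombine h' (hv i) 1
  have : Nonempty (Metric.sphere (0 : Euc d) 1) :=
    ⟨⟨EuclideanSpace.single ⟨0, hd⟩ 1, by simp⟩⟩
  rw [pugErr, protocolErr]
  simp_rw [key]
  exact ciSup_const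

/-! ### Existence of optimal parameters -/

/-- The value of `p` for which the privacy constraint `p / (1 - q) ≤ exp ε * ((1 - p) / q)` is an
equality. -/
noncomputable def tightParam (ε q : ℝ) : ℝ :=
  Real.exp ε * (1 - q) / (q + Real.exp ε * (1 - q))

theorem tightParam_denom_ge_one {ε q : ℝ} (hε : 0 < ε) (hq1 : q < 1) :
    1 ≤ q + Real.exp ε * (1 - q) := by
  have := Real.one_lt_exp_iff.2 hε
  nlinarith

theorem tightParam_div {ε q : ℝ} (hε : 0 < ε) (hq1 : q < 1) :
    tightParam ε q / (1 - q) = Real.exp ε / (q + Real.exp ε * (1 - q)) := by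
  have h1 := tightParam_denom_ge_one hε hq1
  have h2 : 1 - q ≠ 0 := by linarith
  rw [tightParam]
  field_simp

theorem one_sub_tightParam_div {ε q : ℝ} (hε : 0 < ε) (hq0 : 0 < q) (hq1 : q < 1) :
    (1 - tightParam ε q) / q = 1 / (q + Real.exp ε * (1 - q)) := by
  have h1 := tightParam_denom_ge_one hε hq1
  have h2 : q + Real.exp ε * (1 - q) ≠ 0 := by linarith
  rw [tightParam, one_sub_div h2]
  field_simp
  ring

theorem pugAdmissible_tightParam {ε q : ℝ} (hε : 0 < ε) (hq0 : 0 < q) (hq1 : q < 1) :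
    PugAdmissible ε (tightParam ε q) q := by
  have h1 := tightParam_denom_ge_one hε hq1
  have h2 := Real.one_lt_exp_iff.2 hε
  have h3 : 0 < 1 - q := by linarith
  refine ⟨by rw [tightParam]; positivity, ?_, hq0, hq1, ?_, ?_⟩
  · rw [tightParam, div_lt_one (by linarith)]; linarith
  · have : 1 - q < tightParam ε q := by
      rw [tightParam, lt_div_iff₀ (by linarith)]
      nlinarith [mul_pos (mul_pos h3 hq0) (sub_pos.2 h2)]
    linarith
  · rw [tightParam_div hε hq1, one_sub_tightParam_div hε hq0 hq1, mul_one_div]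

theorem PugAdmissible.le_tightParam {ε p q : ℝ} (hε : 0 < ε) (h : PugAdmissible ε p q) :
    p ≤ tightParam ε q := by
  obtain ⟨hp0, hp1, hq0, hq1, -, hc⟩ := h
  have h1 := tightParam_denom_ge_one hε hq1
  rw [mul_div_assoc', div_le_div_iff₀ (by linarith) hq0] at hc
  rw [tightParam, le_div_iff₀ (by linarith)]
  nlinarith

theorem pugSignal_mono {p p' q : ℝ} (hq0 : 0 < q) (hq1 : q < 1) (h : p ≤ p') :
    pugSignal p q ≤ pugSignal p' q := by
  have h3 : 0 < 1 - q := by linarith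
  rw [pugSignal, pugSignal]
  gcongr
  exact (stdNormalPdf_pos _).le

theorem one_le_pugSecondMoment_one {ε p q : ℝ} (h : PugAdmissible ε p q) :
    1 ≤ 1 / pugSignal p q ^ 2 + stdNormalQuantile q / pugSignal p q := by
  have hs := h.pugSignal_pos
  obtain ⟨hp0, hp1, hq0, hq1, -, -⟩ := h
  have hsq := pugSignal_sq_le hp0.le hp1.le hq0 hq1
  have : 1 / pugSignal p q ^ 2 + stdNormalQuantile q / pugSignal p q =
      (1 + stdNormalQuantile q * pugSignal p q) / pugSignal p q ^ 2 := by
    field_simp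
  rw [this, le_div_iff₀ (by positivity)]
  linarith

/-- For a given `q`, the error is smallest when the privacy constraint is tight. -/
theorem pugSecondMoment_tightParam_le {ε p q : ℝ} (hε : 0 < ε) {d : ℕ} (hd : 1 ≤ d)
    (h : PugAdmissible ε p q) :
    pugSecondMoment d (tightParam ε q) q ≤ pugSecondMoment d p q := by
  have hs := h.pugSignal_pos
  have hle := h.le_tightParam hε
  obtain ⟨hp0, hp1, hq0, hq1, -, -⟩ := h
  have ht := pugAdmissible_tightParam hε hq0 hq1
  have hs' := ht.pugSignal_pos
  have hmono := pugSignal_mono hq0 hq1 hle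
  have h1 := one_le_pugSecondMoment_one ht
  have hr : (pugSignal (tightParam ε q) q)⁻¹ ≤ (pugSignal p q)⁻¹ := inv_anti₀ hs hmono
  have hr0 := inv_pos.2 hs'
  have hd1 : (1 : ℝ) ≤ d := by exact_mod_cast hd
  simp only [pugSecondMoment, div_eq_mul_inv, ← inv_pow, one_mul] at h1 ⊢
  generalize (pugSignal (tightParam ε q) q)⁻¹ = r at *
  generalize (pugSignal p q)⁻¹ = r' at *
  generalize stdNormalQuantile q = t at *
  have h2 : 0 ≤ r + t := by
    by_contra! hneg
    nlinarith
  have h3 : 0 ≤ d * (r' + r) + t := by nlinarith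
  nlinarith [mul_nonneg (sub_nonneg.2 hr) h3]

open Filter Topology in
theorem exists_pugOptimal {ε : ℝ} (hε : 0 < ε) {d : ℕ} (hd : 1 ≤ d) :
    ∃ p q : ℝ, PugOptimal ε d p q := by
  set E := Real.exp ε
  have hE : 0 < E - 1 := sub_pos.2 (Real.one_lt_exp_iff.2 hε)
  have hd1 : (1 : ℝ) ≤ d := by exact_mod_cast hd
  set Φ : ℝ → ℝ := fun t => cdf (gaussianReal 0 1) t
  set φ : ℝ → ℝ := gaussianPDFReal 0 1
  -- the reciprocal of the signal for tight parameters with threshold `t`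
  set r : ℝ → ℝ := fun t => (Φ t + E * (1 - Φ t)) / ((E - 1) * φ t)
  set g : ℝ → ℝ := fun t => d * r t ^ 2 + t * r t
  have hφ : ∀ t, 0 < φ t := stdNormalPdf_pos
  have hφc : Continuous φ :=
    continuous_iff_continuousAt.2 fun t => (hasDerivAt_stdNormalPdf t).continuousAt
  have hΦc : Continuous Φ := continuous_stdNormalCdf
  have hrc : Continuous r :=
    (hΦc.add (continuous_const.mul (continuous_const.sub hΦc))).div (continuous_const.mul hφc)
      fun t => (mul_pos hE (hφ t)).ne'
  have hgc : Continuous g := by fun_prop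
  have hg : ∀ t, pugSecondMoment d (tightParam ε (Φ t)) (Φ t) = g t := by
    intro t
    have h1 := tightParam_denom_ge_one hε (stdNormalCdf_lt_one t)
    have hr : pugSignal (tightParam ε (Φ t)) (Φ t) = (r t)⁻¹ := by
      rw [pugSignal, tightParam_div hε (stdNormalCdf_lt_one t),
        one_sub_tightParam_div hε (stdNormalCdf_pos t) (stdNormalCdf_lt_one t),
        stdNormalQuantile_cdf, ← sub_div]
      simp only [r, inv_div]
      ring
    rw [pugSecondMoment, hr, stdNormalQuantile_cdf]
    simp [g]
  have hlim : Tendsto g (cocompact ℝ) atTop := by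
    have hx : Tendsto (fun t : ℝ => ‖t‖ ^ 2) (cocompact ℝ) atTop :=
      (tendsto_pow_atTop two_ne_zero).comp (tendsto_norm_cocompact_atTop (E := ℝ))
    set K := 1 / (E - 1) with hK
    have hK0 : 0 < K := by positivity
    have h2 : Tendsto (fun x : ℝ => x * (K ^ 2 / 4 * x + -(1 / 2))) atTop atTop :=
      tendsto_id.atTop_mul_atTop₀
        (tendsto_atTop_add_const_right _ _ (tendsto_id.const_mul_atTop (by positivity)))
    refine tendsto_atTop_mono (fun t => ?_) (h2.comp hx)
    have hexp : Real.exp (t ^ 2 / 2) ≤ 1 / φ t := by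
      simp only [φ, stdNormalPdf_eq]
      rw [one_div, mul_inv, inv_inv, ← Real.exp_neg, neg_div, neg_neg]
      refine le_mul_of_one_le_left (Real.exp_pos _).le ?_
      rw [Real.one_le_sqrt]
      linarith [Real.pi_gt_three]
    have hrK : K * Real.exp (t ^ 2 / 2) ≤ r t := by
      calc K * Real.exp (t ^ 2 / 2) ≤ 1 / (E - 1) * (1 / φ t) := by gcongr
        _ = 1 / ((E - 1) * φ t) := by rw [one_div_mul_one_div]
        _ ≤ r t := by
          have := hφ t
          simp only [r]
          gcongr
          exact tightParam_denom_ge_one hε (stdNormalCdf_lt_one t)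
    -- a quartic lower bound on `r ^ 2` beats the term `t * r`, which is at least
    -- `-(r ^ 2 + t ^ 2) / 2`
    have hr2 : K ^ 2 * ((t ^ 2) ^ 2 / 2) ≤ r t ^ 2 := by
      calc K ^ 2 * ((t ^ 2) ^ 2 / 2) ≤ K ^ 2 * Real.exp (t ^ 2) := by
            gcongr
            have := Real.quadratic_le_exp_of_nonneg (sq_nonneg t)
            nlinarith [sq_nonneg t]
        _ = (K * Real.exp (t ^ 2 / 2)) ^ 2 := by
            rw [mul_pow, ← Real.exp_nat_mul]; congr 2; push_cast; ring
        _ ≤ r t ^ 2 := by gcongr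
    simp only [Function.comp, Real.norm_eq_abs, sq_abs, g]
    nlinarith [sq_nonneg (r t + t), mul_nonneg (sub_nonneg.2 hd1) (sq_nonneg (r t))]
  obtain ⟨t, ht⟩ := hgc.exists_forall_le hlim
  have hadm := pugAdmissible_tightParam hε (stdNormalCdf_pos t) (stdNormalCdf_lt_one t)
  refine ⟨tightParam ε (Φ t), Φ t, hadm, fun p' q' h' => ?_⟩
  rw [pugErr_eq le_rfl hd hadm, pugErr_eq le_rfl hd h']
  apply ENNReal.ofReal_le_ofReal
  have h1 := pugSecondMoment_tightParam_le hε hd h'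
  have h2 : pugSecondMoment d (tightParam ε q') q' = g (stdNormalQuantile q') := by
    rw [← hg]
    simp only [Φ]
    rw [cdf_stdNormalQuantile h'.2.2.1 h'.2.2.2.1]
  have h3 := ht (stdNormalQuantile q')
  rw [← hg t] at h3
  gcongr
  linarith

/-! ### Comparing the errors in dimensions `k` and `d` -/

theorem PugOptimal.secondMoment_le {ε : ℝ} {d : ℕ} (hd : 1 ≤ d) {p q p' q' : ℝ}
    (h : PugOptimal ε d p q) (h' : PugAdmissible ε p' q') :
    pugSecondMoment d p q ≤ pugSecondMoment d p' q' := by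
  have h1 := h.2 p' q' h'
  rw [pugErr_eq le_rfl hd h.1, pugErr_eq le_rfl hd h', ENNReal.ofReal_le_ofReal_iff'] at h1
  have hge : ∀ {a b : ℝ}, PugAdmissible ε a b → 1 ≤ pugSecondMoment d a b := fun {a b} hab => by
    have h2 := one_le_pugSecondMoment_one hab
    have hd1 : (1 : ℝ) ≤ d := by exact_mod_cast hd
    have : 1 / pugSignal a b ^ 2 ≤ d / pugSignal a b ^ 2 := by gcongr
    rw [pugSecondMoment]
    linarith
  have := hge h'
  rcases h1 with h1 | h1 <;> · simp at h1; linarith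

theorem pugSecondMoment_sub_one_ge {ε p q : ℝ} (h : PugAdmissible ε p q) (d : ℕ) :
    (d - 1) / pugSignal p q ^ 2 ≤ pugSecondMoment d p q - 1 := by
  have := one_le_pugSecondMoment_one h
  rw [pugSecondMoment, sub_div]
  linarith

/-- The signal cannot be large together with the threshold: below `t = 2 √ε` this is the variance
inequality, above it the density factor `φ(t)` beats the factor `exp ε` of the likelihood ratio. -/
theorem quantile_mul_pugSignal_le {ε p q : ℝ} (hε : 0 < ε) (h : PugAdmissible ε p q) :
    stdNormalQuantile q * pugSignal p q ≤ 1 + 8 * ε := by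
  have hs := h.pugSignal_pos
  obtain ⟨hp0, hp1, hq0, hq1, hpq, hc⟩ := h
  have hsq := pugSignal_sq_le hp0.le hp1.le hq0 hq1
  have hdens : pugSignal p q ≤ gaussianPDFReal 0 1 (stdNormalQuantile q) * Real.exp ε := by
    rw [pugSignal]
    refine mul_le_mul_of_nonneg_left ?_ (stdNormalPdf_pos _).le
    have h1 : (1 - p) / q ≤ 1 := by rw [div_le_one hq0]; linarith
    have h2 : 0 ≤ (1 - p) / q := div_nonneg (by linarith) hq0.le
    nlinarith [Real.exp_pos ε]
  generalize pugSignal p q = s at *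
  generalize stdNormalQuantile q = t at *
  rcases le_or_gt t 0 with ht | ht
  · nlinarith
  rcases le_or_gt (t ^ 2) (4 * ε) with h4 | h4
  · have h5 : s ≤ t + 1 := by
      by_contra! hlt
      nlinarith
    nlinarith [sq_nonneg (t - 1)]
  · have h6 : s ≤ Real.exp (-(t ^ 2 / 4)) := by
      calc s ≤ gaussianPDFReal 0 1 t * Real.exp ε := hdens
        _ ≤ Real.exp (-t ^ 2 / 2) * Real.exp ε := by
          rw [stdNormalPdf_eq]
          gcongr
          refine mul_le_of_le_one_left (Real.exp_pos _).le (inv_le_one_of_one_le₀ ?_)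
          rw [Real.one_le_sqrt]
          linarith [Real.pi_gt_three]
        _ = Real.exp (-t ^ 2 / 2 + ε) := (Real.exp_add _ _).symm
        _ ≤ _ := Real.exp_le_exp.2 (by linarith)
    have h7 : Real.exp (t ^ 2 / 4) ≥ t := by
      have := Real.add_one_le_exp (t ^ 2 / 4)
      nlinarith [sq_nonneg (t - 2)]
    have h8 : t * s ≤ 1 := by
      calc t * s ≤ Real.exp (t ^ 2 / 4) * Real.exp (-(t ^ 2 / 4)) := by gcongr
        _ = 1 := by rw [← Real.exp_add, add_neg_cancel, Real.exp_zero]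
    linarith

/-- If the second moment in dimension `k` is inflated by at most the factor `d / a`, where
`k ≤ a + 1`, the resulting error is comparable with the optimal error in dimension `d`. -/
theorem inflated_error_le {ε : ℝ} (hε : 0 < ε) {k d : ℕ} (hk : 1 ≤ k) (hd : 2 ≤ d)
    {p q p' q' : ℝ} (h : PugOptimal ε k p q) (h' : PugAdmissible ε p' q') {G a : ℝ} (ha : 0 < a)
    (had : a ≤ d) (hka : (k : ℝ) ≤ a + 1) (hG : G ≤ d / a) :
    G * pugSecondMoment k p q - 1 ≤
      (pugSecondMoment d p' q' - 1) * (1 + (4 + 16 * ε) / a) := by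
  have h1 := h.secondMoment_le hk h'
  have hk1 : (1 : ℝ) ≤ k := by exact_mod_cast hk
  have hd2 : (2 : ℝ) ≤ d := by exact_mod_cast hd
  have hpos : 0 ≤ pugSecondMoment k p q := by
    have h2 := one_le_pugSecondMoment_one h.1
    have : 1 / pugSignal p q ^ 2 ≤ k / pugSignal p q ^ 2 := by gcongr
    rw [pugSecondMoment]
    linarith
  have hts := quantile_mul_pugSignal_le hε h'
  have hB := pugSecondMoment_sub_one_ge h' d
  have hs := h'.pugSignal_pos
  have hA : G * pugSecondMoment k p q ≤ d / a * pugSecondMoment k p' q' :=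
    mul_le_mul hG h1 hpos (by positivity)
  set s := pugSignal p' q' with hs_def
  set t := stdNormalQuantile q' with ht_def
  set B := pugSecondMoment d p' q' - 1 with hB_def
  have hBd : d / s ^ 2 ≤ 2 * B := by
    have : d / s ^ 2 ≤ 2 * ((d - 1) / s ^ 2) := by
      rw [mul_div_assoc']
      gcongr
      linarith
    linarith
  have hB' : B = d / s ^ 2 + t / s - 1 := by rw [hB_def, pugSecondMoment]
  have hk' : pugSecondMoment k p' q' = k / s ^ 2 + t / s := rfl
  have hda : 1 ≤ d / a := by rwa [one_le_div ha]
  -- the difference of the errors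
  have hdiff : d / a * pugSecondMoment k p' q' - 1 - B ≤ d / s ^ 2 * ((2 + 8 * ε) / a) := by
    have e1 : d / a * (k / s ^ 2) ≤ d / s ^ 2 + d / s ^ 2 * (1 / a) := by
      have : d / s ^ 2 + d / s ^ 2 * (1 / a) = d / a * ((a + 1) / s ^ 2) := by field_simp
      rw [this]
      gcongr
    have e2 : (d / a - 1) * (t / s) ≤ d / s ^ 2 * ((1 + 8 * ε) / a) := by
      have e3 : t / s = t * s / s ^ 2 := by field_simp
      have e4 : d / s ^ 2 * ((1 + 8 * ε) / a) = d / a * ((1 + 8 * ε) / s ^ 2) := by field_simp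
      rw [e3, e4]
      have e5 : t * s / s ^ 2 ≤ (1 + 8 * ε) / s ^ 2 := by gcongr
      have e6 : 0 ≤ (1 + 8 * ε) / s ^ 2 := by positivity
      calc (d / a - 1) * (t * s / s ^ 2) ≤ (d / a - 1) * ((1 + 8 * ε) / s ^ 2) :=
            mul_le_mul_of_nonneg_left e5 (by linarith)
        _ ≤ d / a * ((1 + 8 * ε) / s ^ 2) := by nlinarith
    have e7 : d / s ^ 2 * ((2 + 8 * ε) / a) =
        d / s ^ 2 * (1 / a) + d / s ^ 2 * ((1 + 8 * ε) / a) := by ring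
    rw [e7, hk', hB']
    nlinarith
  have hfin : d / s ^ 2 * ((2 + 8 * ε) / a) ≤ B * ((4 + 16 * ε) / a) := by
    calc d / s ^ 2 * ((2 + 8 * ε) / a) ≤ 2 * B * ((2 + 8 * ε) / a) := by gcongr
      _ = _ := by ring
  rw [mul_add, mul_one]
  linarith

/-! ### The mean norm of a standard Gaussian vector -/

theorem integrable_exp_neg_norm_sq (d : ℕ) :
    Integrable (fun x : Euc d => Real.exp (-(1 / 2) * ‖x‖ ^ 2)) := by
  have h := GaussianFourier.integrable_cexp_neg_mul_sq_norm_add (b := 1 / 2) (V := Euc d)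
    (by norm_num) 0 0
  refine h.re.congr (ae_of_all _ fun x => ?_)
  simp only [zero_mul, add_zero]
  rw [← Complex.exp_ofReal_re]
  push_cast
  rfl

/-- The standard Gaussian law has density `(2π)^(-d/2) exp(-‖x‖²/2)`. -/
theorem stdGaussian_eq_withDensity (d : ℕ) :
    stdGaussian (Euc d) = volume.withDensity fun x : Euc d =>
      ENNReal.ofReal (((2 * Real.pi) ^ ((d : ℝ) / 2))⁻¹ * Real.exp (-(1 / 2) * ‖x‖ ^ 2)) := by
  have hint := (integrable_exp_neg_norm_sq d).const_mul ((2 * Real.pi) ^ ((d : ℝ) / 2))⁻¹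
  have := isFiniteMeasure_withDensity_ofReal hint.2
  apply Measure.ext_of_charFun
  ext t
  rw [charFun_stdGaussian, charFun_apply, integral_withDensity_eq_integral_toReal_smul
    (by fun_prop) (ae_of_all _ fun x => ENNReal.ofReal_lt_top)]
  have h : ∀ x : Euc d, (ENNReal.ofReal (((2 * Real.pi) ^ ((d : ℝ) / 2))⁻¹ *
      Real.exp (-(1 / 2) * ‖x‖ ^ 2))).toReal • Complex.exp (inner ℝ x t * Complex.I) =
      (((2 * Real.pi) ^ ((d : ℝ) / 2) : ℝ) : ℂ)⁻¹ *
        Complex.exp (-(1 / 2) * ‖x‖ ^ 2 + Complex.I * (inner ℝ t x : ℝ)) := by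
    intro x
    rw [ENNReal.toReal_ofReal (by positivity), Complex.real_smul, Complex.exp_add,
      real_inner_comm x t]
    push_cast
    rw [mul_assoc, mul_comm Complex.I]
  simp_rw [h]
  have hF := GaussianFourier.integral_cexp_neg_mul_sq_norm_add (b := 1 / 2) (V := Euc d)
    (by norm_num) Complex.I t
  rw [integral_const_mul, hF, Complex.ofReal_cpow (by positivity)]
  have h2 : (Real.pi : ℂ) / (1 / 2) = 2 * Real.pi := by ring
  have h3 : ((2 : ℂ) * Real.pi) ^ ((d : ℂ) / 2) ≠ 0 := by
    rw [Complex.cpow_ne_zero_iff]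
    left
    exact_mod_cast (by positivity : (2 * Real.pi : ℝ) ≠ 0)
  rw [h2, finrank_euclideanSpace_fin]
  push_cast
  rw [← mul_assoc, inv_mul_cancel₀ h3, one_mul, Complex.I_sq]
  congr 1
  ring

theorem stdGaussian_singleton_zero {d : ℕ} (hd : 1 ≤ d) : stdGaussian (Euc d) {0} = 0 := by
  have : Nontrivial (Euc d) := by
    have : Nonempty (Fin d) := ⟨⟨0, hd⟩⟩
    infer_instance
  rw [stdGaussian_eq_withDensity]
  exact withDensity_absolutelyContinuous _ _ (measure_singleton _)

theorem integral_pow_mul_exp_neg_sq (m : ℕ) :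
    ∫ y in Set.Ioi (0 : ℝ), y ^ m * Real.exp (-(1 / 2) * y ^ 2) =
      (1 / 2 : ℝ) ^ (-((m : ℝ) + 1) / 2) * (1 / 2) * Real.Gamma (((m : ℝ) + 1) / 2) := by
  rw [← integral_rpow_mul_exp_neg_mul_rpow (p := 2) (q := m) (b := 1 / 2) (by norm_num)
    (by linarith [(Nat.cast_nonneg m : (0 : ℝ) ≤ m)]) (by norm_num)]
  simp

theorem integral_norm_stdGaussian {d : ℕ} (hd : 1 ≤ d) :
    ∫ g, ‖g‖ ∂(stdGaussian (Euc d)) =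
      Real.sqrt 2 * Real.Gamma ((d + 1) / 2) / Real.Gamma (d / 2) := by
  set Z : ℝ := ((2 * Real.pi) ^ ((d : ℝ) / 2))⁻¹
  have hrad : ∀ f : ℝ → ℝ, ∫ g, f ‖g‖ ∂(stdGaussian (Euc d)) =
      Z * (d * (volume.real (Metric.ball (0 : Euc d) 1) *
        ∫ y in Set.Ioi (0 : ℝ), y ^ (d - 1) * (Real.exp (-(1 / 2) * y ^ 2) * f y))) := by
    intro f
    have : Nonempty (Fin d) := ⟨⟨0, hd⟩⟩
    rw [stdGaussian_eq_withDensity, integral_withDensity_eq_integral_toReal_smul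
      (by fun_prop) (ae_of_all _ fun x => ENNReal.ofReal_lt_top)]
    have h : ∀ x : Euc d, (ENNReal.ofReal (Z * Real.exp (-(1 / 2) * ‖x‖ ^ 2))).toReal • f ‖x‖ =
        Z * (Real.exp (-(1 / 2) * ‖x‖ ^ 2) * f ‖x‖) := by
      intro x
      rw [ENNReal.toReal_ofReal (by positivity), smul_eq_mul, mul_assoc]
    refine (integral_congr_ae (ae_of_all _ h)).trans ?_
    rw [integral_const_mul, integral_fun_norm_addHaar volume
      (fun y => Real.exp (-(1 / 2) * y ^ 2) * f y), finrank_euclideanSpace_fin]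
    simp only [nsmul_eq_mul, smul_eq_mul]
  have h0 := hrad (fun _ => 1)
  have h1 := hrad (fun y => y)
  simp only [mul_one, integral_const, probReal_univ, smul_eq_mul] at h0
  have e1 : ∀ y : ℝ, y ^ (d - 1) * (Real.exp (-(1 / 2) * y ^ 2) * y) =
      y ^ d * Real.exp (-(1 / 2) * y ^ 2) := by
    intro y
    obtain ⟨m, rfl⟩ : ∃ m, d = m + 1 := ⟨d - 1, by omega⟩
    simp only [Nat.add_sub_cancel]
    ring
  simp_rw [e1] at h1
  rw [integral_pow_mul_exp_neg_sq] at h0 h1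
  have e2 : ((d - 1 : ℕ) : ℝ) + 1 = d := by
    rw [Nat.cast_sub hd]; simp
  rw [e2] at h0
  have hd0 : (0 : ℝ) < d := by exact_mod_cast hd
  have hG := Real.Gamma_pos_of_pos (half_pos hd0)
  have e3 : (1 / 2 : ℝ) ^ (-((d : ℝ) + 1) / 2) = (1 / 2 : ℝ) ^ (-(d : ℝ) / 2) * Real.sqrt 2 := by
    have : Real.sqrt 2 = (1 / 2 : ℝ) ^ (-(1 : ℝ) / 2) := by
      rw [one_div, Real.inv_rpow (by norm_num), ← Real.rpow_neg (by norm_num), Real.sqrt_eq_rpow]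
      norm_num
    rw [this, ← Real.rpow_add (by norm_num)]
    congr 1
    ring
  rw [h1, e3, eq_div_iff hG.ne']
  linear_combination (-(Real.sqrt 2 * Real.Gamma ((d + 1) / 2))) * h0

/-! ### Matrix-vector products -/

theorem matVec_mul {k l d : ℕ} (A : Matrix (Fin k) (Fin l) ℝ) (B : Matrix (Fin l) (Fin d) ℝ)
    (v : Euc d) : matVec (A * B) v = matVec A (matVec B v) := by
  simp [matVec, Matrix.mulVec_mulVec]

theorem matVec_one {d : ℕ} (v : Euc d) : matVec 1 v = v := by simp [matVec]

theorem matVec_smul {k d : ℕ} (A : Matrix (Fin k) (Fin d) ℝ) (r : ℝ) (v : Euc d) :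
    matVec A (r • v) = r • matVec A v := by simp [matVec, Matrix.mulVec_smul]

theorem smul_matVec {k d : ℕ} (A : Matrix (Fin k) (Fin d) ℝ) (r : ℝ) (v : Euc d) :
    matVec (r • A) v = r • matVec A v := by simp [matVec, Matrix.smul_mulVec]

theorem inner_matVec_left {k d : ℕ} (A : Matrix (Fin k) (Fin d) ℝ) (v : Euc d) (w : Euc k) :
    (inner ℝ (matVec A v) w : ℝ) = inner ℝ v (matVec Aᵀ w) := by
  simp only [matVec, EuclideanSpace.inner_eq_star_dotProduct, star_trivial]
  rw [Matrix.dotProduct_mulVec, Matrix.mulVec_transpose, dotProduct_comm]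

theorem continuous_matVec {k d : ℕ} :
    Continuous fun x : Matrix (Fin k) (Fin d) ℝ × Euc d => matVec x.1 x.2 := by
  unfold matVec
  exact (PiLp.continuous_toLp 2 _).comp
    (continuous_fst.matrix_mulVec ((PiLp.continuous_ofLp 2 _).comp continuous_snd))

/-- The map `v ↦ A v` as a continuous linear map of Euclidean spaces. -/
noncomputable def matVecCLM {k d : ℕ} (A : Matrix (Fin k) (Fin d) ℝ) : Euc d →L[ℝ] Euc k :=
  LinearMap.toContinuousLinearMap
    { toFun := matVec A
      map_add' := fun v w => by simp [matVec, Matrix.mulVec_add]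
      map_smul' := fun r v => matVec_smul A r v }

theorem matVecCLM_apply {k d : ℕ} (A : Matrix (Fin k) (Fin d) ℝ) (v : Euc d) :
    matVecCLM A v = matVec A v := rfl

instance instSecondCountableTopologyRealMatrix {m n : Type*} [Countable m] [Countable n] :
    SecondCountableTopology (Matrix m n ℝ) :=
  inferInstanceAs (SecondCountableTopology (m → n → ℝ))

@[fun_prop]
theorem measurable_matVec {Ω : Type*} [MeasurableSpace Ω] {k d : ℕ}
    {A : Ω → Matrix (Fin k) (Fin d) ℝ} {v : Ω → Euc d} (hA : Measurable A) (hv : Measurable v) :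
    Measurable fun ω => matVec (A ω) (v ω) :=
  continuous_matVec.measurable.comp (hA.prodMk hv)

@[fun_prop]
theorem measurable_matrix_transpose {k d : ℕ} :
    Measurable fun A : Matrix (Fin k) (Fin d) ℝ => Aᵀ :=
  (continuous_id.matrix_transpose).measurable

@[fun_prop]
theorem measurable_normalizeVec {k : ℕ} : Measurable (normalizeVec : Euc k → Euc k) := by
  unfold normalizeVec; fun_prop

theorem norm_normalizeVec {k : ℕ} {x : Euc k} (hx : x ≠ 0) : ‖normalizeVec x‖ = 1 := by
  rw [normalizeVec, norm_smul, norm_inv, norm_norm, inv_mul_cancel₀ (norm_ne_zero_iff.2 hx)]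

theorem norm_normalizeVec_le {k : ℕ} (x : Euc k) : ‖normalizeVec x‖ ≤ 1 := by
  rcases eq_or_ne x 0 with rfl | hx
  · simp [normalizeVec]
  · exact (norm_normalizeVec hx).le

theorem inner_normalizeVec {k : ℕ} (x : Euc k) : (inner ℝ x (normalizeVec x) : ℝ) = ‖x‖ := by
  rw [normalizeVec, inner_smul_right, real_inner_self_eq_norm_sq]
  rcases eq_or_ne x 0 with rfl | hx
  · simp
  · have := norm_ne_zero_iff.2 hx
    field_simp

theorem norm_sq_matVec_transpose {k d : ℕ} {A : Matrix (Fin k) (Fin d) ℝ} {r : ℝ}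
    (hA : A * Aᵀ = r • (1 : Matrix (Fin k) (Fin k) ℝ)) (x : Euc k) :
    ‖matVec Aᵀ x‖ ^ 2 = r * ‖x‖ ^ 2 := by
  rw [← real_inner_self_eq_norm_sq, inner_matVec_left, Matrix.transpose_transpose, ← matVec_mul,
    hA, smul_matVec, matVec_one, inner_smul_right, real_inner_self_eq_norm_sq]

/-- The matrix of the map `x ↦ 2 ⟨w, x⟩ w - x`, the reflection in the line spanned by `w` when `w`
is a unit vector. -/
def lineReflection {d : ℕ} (w : Euc d) : Matrix (Fin d) (Fin d) ℝ :=
  (2 : ℝ) • Matrix.vecMulVec w.ofLp w.ofLp - 1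

theorem matVec_lineReflection {d : ℕ} (w x : Euc d) :
    matVec (lineReflection w) x = (2 * inner ℝ w x : ℝ) • w - x := by
  have h : (inner ℝ w x : ℝ) = w.ofLp ⬝ᵥ x.ofLp := by
    rw [EuclideanSpace.inner_eq_star_dotProduct, star_trivial, dotProduct_comm]
  ext i
  simp [matVec, lineReflection, Matrix.sub_mulVec, Matrix.smul_mulVec, Matrix.vecMulVec_mulVec, h]
  ring

theorem transpose_lineReflection {d : ℕ} (w : Euc d) : (lineReflection w)ᵀ = lineReflection w := by
  simp [lineReflection, Matrix.transpose_sub, Matrix.transpose_vecMulVec]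

theorem ext_matVec {k d : ℕ} {A B : Matrix (Fin k) (Fin d) ℝ} (h : ∀ v, matVec A v = matVec B v) :
    A = B := by
  apply Matrix.mulVec_injective
  ext1 x
  exact congrArg WithLp.ofLp (h (WithLp.toLp 2 x))

theorem lineReflection_mem_orthogonalGroup {d : ℕ} {w : Euc d} (hw : ‖w‖ = 1) :
    lineReflection w ∈ Matrix.orthogonalGroup (Fin d) ℝ := by
  rw [Matrix.mem_orthogonalGroup_iff]
  change lineReflection w * (lineReflection w)ᵀ = 1
  rw [transpose_lineReflection]
  apply ext_matVec
  intro x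
  rw [matVec_mul, matVec_one, matVec_lineReflection, matVec_lineReflection, inner_sub_right,
    inner_smul_right, real_inner_self_eq_norm_sq, hw, ← sub_add, ← sub_smul]
  ring_nf
  simp

/-- The orthogonal group acts transitively on the unit sphere. -/
theorem exists_orthogonal_matVec_eq {d : ℕ} {v w : Euc d} (hv : ‖v‖ = 1) (hw : ‖w‖ = 1) :
    ∃ Q ∈ Matrix.orthogonalGroup (Fin d) ℝ, matVec Q v = w := by
  rcases eq_or_ne (v + w) 0 with h0 | h0
  · refine ⟨-1, ?_, ?_⟩
    · rw [Matrix.mem_orthogonalGroup_iff]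
      simp
    · rw [eq_neg_of_add_eq_zero_right h0]
      simp [matVec, Matrix.neg_mulVec]
  · -- reflect in the bisector of `v` and `w`
    refine ⟨lineReflection (normalizeVec (v + w)),
      lineReflection_mem_orthogonalGroup (norm_normalizeVec h0), ?_⟩
    have hn : ‖v + w‖ ^ 2 ≠ 0 := pow_ne_zero 2 (norm_ne_zero_iff.2 h0)
    have hn2 : ‖v + w‖ ^ 2 = 2 * (1 + inner ℝ w v) := by
      rw [norm_add_sq_real, hv, hw, real_inner_comm]; ring
    rw [matVec_lineReflection, normalizeVec, inner_smul_left, smul_smul, inner_add_left,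
      real_inner_self_eq_norm_sq, hv]
    have : 2 * ((starRingEnd ℝ) ‖v + w‖⁻¹ * (1 ^ 2 + inner ℝ w v)) * ‖v + w‖⁻¹ = 1 := by
      rw [conj_trivial]
      calc 2 * (‖v + w‖⁻¹ * (1 ^ 2 + inner ℝ w v)) * ‖v + w‖⁻¹
          = (2 * (1 + inner ℝ w v)) * (‖v + w‖ ^ 2)⁻¹ := by ring
        _ = 1 := by rw [← hn2, mul_inv_cancel₀ hn]
    rw [this, one_smul]
    abel

/-! ### The law of the random projection -/

theorem samplingMatrix_mul_transpose {k d : ℕ} (s : Fin k ↪ Fin d) :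
    samplingMatrix s * (samplingMatrix s)ᵀ = 1 := by
  ext i j
  simp [samplingMatrix, Matrix.mul_apply, Matrix.one_apply, eq_comm]

theorem measurable_rotationMap (k d : ℕ) :
    Measurable fun x : (Fin k ↪ Fin d) × Matrix.orthogonalGroup (Fin d) ℝ =>
      Real.sqrt (d / k) • (samplingMatrix x.1 * (x.2 : Matrix (Fin d) (Fin d) ℝ)) := by
  refine measurable_from_prod_countable_right fun s => ?_
  have h : Continuous fun U : Matrix.orthogonalGroup (Fin d) ℝ =>
      samplingMatrix s * (U : Matrix (Fin d) (Fin d) ℝ) :=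
    continuous_const.matrix_mul continuous_subtype_val
  exact (h.const_smul (Real.sqrt (d / k))).measurable

theorem isProbabilityMeasure_haarOrthogonal (d : ℕ) : IsProbabilityMeasure
    (Measure.haarMeasure (⊤ : TopologicalSpace.PositiveCompacts
      (Matrix.orthogonalGroup (Fin d) ℝ))) := by
  constructor
  have := Measure.haarMeasure_self (K₀ := (⊤ : TopologicalSpace.PositiveCompacts
      (Matrix.orthogonalGroup (Fin d) ℝ)))
  simpa using this

/-- Haar measure on the compact group `O(d)` is right invariant, by uniqueness of the left
invariant probability measure. -/
theorem map_mul_right_haarOrthogonal (d : ℕ) (Q : Matrix.orthogonalGroup (Fin d) ℝ) :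
    (Measure.haarMeasure (⊤ : TopologicalSpace.PositiveCompacts
      (Matrix.orthogonalGroup (Fin d) ℝ))).map (· * Q) =
    Measure.haarMeasure (⊤ : TopologicalSpace.PositiveCompacts
      (Matrix.orthogonalGroup (Fin d) ℝ)) := by
  have := isProbabilityMeasure_haarOrthogonal d
  have := Measure.isProbabilityMeasure_map (μ := Measure.haarMeasure
    (⊤ : TopologicalSpace.PositiveCompacts (Matrix.orthogonalGroup (Fin d) ℝ)))
    (measurable_mul_const Q).aemeasurable
  exact Measure.isHaarMeasure_eq_of_isProbabilityMeasure _ _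

section
variable {k d : ℕ}

theorem isProbabilityMeasure_rotationLaw (hkd : k ≤ d) :
    IsProbabilityMeasure (rotationLaw k d) := by
  have := isProbabilityMeasure_haarOrthogonal d
  have : Nonempty (Fin k ↪ Fin d) := ⟨Fin.castLEEmb hkd⟩
  have := isProbabilityMeasure_uniformOn (Set.finite_univ (α := Fin k ↪ Fin d)) Set.univ_nonempty
  exact Measure.isProbabilityMeasure_map (measurable_rotationMap k d).aemeasurable

theorem measurable_matrix_mul_const (Q : Matrix (Fin d) (Fin d) ℝ) :
    Measurable fun W : Matrix (Fin k) (Fin d) ℝ => W * Q :=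
  (continuous_id.matrix_mul continuous_const).measurable

theorem map_mul_right_rotationLaw (hkd : k ≤ d) {Q : Matrix (Fin d) (Fin d) ℝ}
    (hQ : Q ∈ Matrix.orthogonalGroup (Fin d) ℝ) :
    (rotationLaw k d).map (· * Q) = rotationLaw k d := by
  have := isProbabilityMeasure_haarOrthogonal d
  have : Nonempty (Fin k ↪ Fin d) := ⟨Fin.castLEEmb hkd⟩
  have := isProbabilityMeasure_uniformOn (Set.finite_univ (α := Fin k ↪ Fin d)) Set.univ_nonempty
  have hm : Measurable fun U : Matrix.orthogonalGroup (Fin d) ℝ => U * ⟨Q, hQ⟩ :=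
    measurable_mul_const _
  rw [rotationLaw, Measure.map_map (measurable_matrix_mul_const Q) (measurable_rotationMap k d)]
  conv_rhs => rw [← map_mul_right_haarOrthogonal d ⟨Q, hQ⟩, ← Measure.map_id
    (μ := uniformOn (Set.univ : Set (Fin k ↪ Fin d))), Measure.map_prod_map _ _ measurable_id hm,
    Measure.map_map (measurable_rotationMap k d) (measurable_id.prodMap hm)]
  congr 1
  ext1 x
  simp [Matrix.mul_assoc]

theorem ae_rotationLaw_mul_transpose (hk : 1 ≤ k) :
    ∀ᵐ W ∂(rotationLaw k d), W * Wᵀ = ((d : ℝ) / k) • (1 : Matrix (Fin k) (Fin k) ℝ) := by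
  have hset : MeasurableSet {W : Matrix (Fin k) (Fin d) ℝ |
      W * Wᵀ = ((d : ℝ) / k) • (1 : Matrix (Fin k) (Fin k) ℝ)} :=
    (isClosed_eq (continuous_id.matrix_mul continuous_id.matrix_transpose)
      continuous_const).measurableSet
  rw [rotationLaw, ae_map_iff (measurable_rotationMap k d).aemeasurable hset]
  refine ae_of_all _ fun x => ?_
  have hU : (x.2 : Matrix (Fin d) (Fin d) ℝ) * (x.2 : Matrix (Fin d) (Fin d) ℝ)ᵀ = 1 :=
    (Matrix.mem_orthogonalGroup_iff (Fin d) ℝ).1 x.2.2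
  rw [Matrix.transpose_smul, Matrix.smul_mul, Matrix.mul_smul, smul_smul,
    Real.mul_self_sqrt (by positivity), Matrix.transpose_mul, Matrix.mul_assoc,
    ← Matrix.mul_assoc x.2.1, hU, Matrix.one_mul, samplingMatrix_mul_transpose]

/-- A rescaled coisometry maps a standard Gaussian vector to a rescaled standard Gaussian vector. -/
theorem map_matVec_stdGaussian {A : Matrix (Fin k) (Fin d) ℝ} {r : ℝ}
    (hA : A * Aᵀ = r ^ 2 • (1 : Matrix (Fin k) (Fin k) ℝ)) :
    (stdGaussian (Euc d)).map (matVec A) = (stdGaussian (Euc k)).map (r • ·) := by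
  have hm : Measurable (matVec A) := by fun_prop
  have := Measure.isProbabilityMeasure_map (μ := stdGaussian (Euc d)) hm.aemeasurable
  have := Measure.isProbabilityMeasure_map (μ := stdGaussian (Euc k))
    (measurable_const_smul r).aemeasurable
  apply Measure.ext_of_charFun
  ext t
  rw [charFun_map_smul, charFun_apply, integral_map hm.aemeasurable (by fun_prop)]
  simp_rw [inner_matVec_left]
  rw [← charFun_apply, charFun_stdGaussian, charFun_stdGaussian, ← Complex.ofReal_pow,
    ← Complex.ofReal_pow, norm_sq_matVec_transpose hA, norm_smul, mul_pow, Real.norm_eq_abs, sq_abs]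

end

/-! ### The projection of a fixed unit vector -/

section
variable {k d : ℕ}

theorem lintegral_matVec_eq (hkd : k ≤ d) {v w : Euc d} (hv : ‖v‖ = 1) (hw : ‖w‖ = 1)
    {F : Euc k → ℝ≥0∞} (hF : Measurable F) :
    ∫⁻ W, F (matVec W v) ∂(rotationLaw k d) = ∫⁻ W, F (matVec W w) ∂(rotationLaw k d) := by
  obtain ⟨Q, hQ, rfl⟩ := exists_orthogonal_matVec_eq hv hw
  conv_lhs => rw [← map_mul_right_rotationLaw hkd hQ]
  rw [lintegral_map (by fun_prop) (measurable_matrix_mul_const Q)]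
  simp_rw [matVec_mul]

/-- Polar decomposition of `W g` for a standard Gaussian vector `g` independent of `W`: on the one
hand `W g` is `‖g‖` times the projection of a unit vector, on the other hand it is a rescaled
standard Gaussian vector. -/
theorem lintegral_norm_smul_matVec (hk : 1 ≤ k) (hkd : k ≤ d) {v : Euc d} (hv : ‖v‖ = 1)
    {F : Euc k → ℝ≥0∞} (hF : Measurable F) :
    ∫⁻ g, ∫⁻ W, F (‖g‖ • matVec W v) ∂(rotationLaw k d) ∂(stdGaussian (Euc d)) =
      ∫⁻ x, F (Real.sqrt (d / k) • x) ∂(stdGaussian (Euc k)) := by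
  have := isProbabilityMeasure_rotationLaw hkd
  have h1 : ∀ g : Euc d, ∫⁻ W, F (‖g‖ • matVec W v) ∂(rotationLaw k d) =
      ∫⁻ W, F (matVec W g) ∂(rotationLaw k d) := by
    intro g
    rcases eq_or_ne g 0 with rfl | hg
    · simp [matVec]
    · rw [lintegral_matVec_eq hkd hv (norm_normalizeVec hg) (F := fun x => F (‖g‖ • x))
        (by fun_prop)]
      simp_rw [← matVec_smul]
      rw [normalizeVec, smul_inv_smul₀ (norm_ne_zero_iff.2 hg)]
  simp_rw [h1]
  rw [lintegral_lintegral_swap (by fun_prop)]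
  have h2 : ∀ᵐ W ∂(rotationLaw k d), ∫⁻ g, F (matVec W g) ∂(stdGaussian (Euc d)) =
      ∫⁻ x, F (Real.sqrt (d / k) • x) ∂(stdGaussian (Euc k)) := by
    filter_upwards [ae_rotationLaw_mul_transpose hk] with W hW
    rw [← Real.sq_sqrt (show 0 ≤ (d : ℝ) / k by positivity)] at hW
    rw [← lintegral_map hF (by fun_prop), map_matVec_stdGaussian hW, lintegral_map hF (by fun_prop)]
  rw [lintegral_congr_ae h2, lintegral_const, measure_univ, mul_one]

/-- If `W v` vanished with positive probability, so would a standard Gaussian vector, by polar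
decomposition. -/
theorem ae_matVec_ne_zero (hk : 1 ≤ k) (hkd : k ≤ d) {v : Euc d} (hv : ‖v‖ = 1) :
    ∀ᵐ W ∂(rotationLaw k d), matVec W v ≠ 0 := by
  have := isProbabilityMeasure_rotationLaw hkd
  have hF : Measurable (Set.indicator {(0 : Euc k)} (fun _ => (1 : ℝ≥0∞))) :=
    measurable_const.indicator (measurableSet_singleton 0)
  have hd0 : (0 : ℝ) < d := by exact_mod_cast hk.trans hkd
  have hk0 : (0 : ℝ) < k := by exact_mod_cast hk
  have hsq : Real.sqrt (d / k) ≠ 0 := (Real.sqrt_pos.2 (by positivity)).ne'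
  have h := lintegral_norm_smul_matVec hk hkd hv hF
  have hr : ∀ x : Euc k, Set.indicator {(0 : Euc k)} (fun _ => (1 : ℝ≥0∞)) (Real.sqrt (d / k) • x) =
      Set.indicator {(0 : Euc k)} (fun _ => (1 : ℝ≥0∞)) x := by
    intro x
    simp only [Set.indicator_apply, Set.mem_singleton_iff, smul_eq_zero, hsq, false_or]
  simp_rw [hr] at h
  rw [lintegral_indicator (measurableSet_singleton 0), setLIntegral_const,
    stdGaussian_singleton_zero hk, mul_zero,
    lintegral_eq_zero_iff (by fun_prop)] at h
  have hg : ∀ᵐ g ∂(stdGaussian (Euc d)), g ≠ 0 := by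
    rw [ae_iff]
    simpa using stdGaussian_singleton_zero (hk.trans hkd)
  obtain ⟨g, h1, hg0⟩ := (h.and hg).exists
  rw [Pi.zero_apply, lintegral_eq_zero_iff (by fun_prop)] at h1
  filter_upwards [h1] with W hW h0
  simp [h0] at hW

theorem norm_matVec_transpose {W : Matrix (Fin k) (Fin d) ℝ}
    (hW : W * Wᵀ = ((d : ℝ) / k) • (1 : Matrix (Fin k) (Fin k) ℝ)) (x : Euc k) :
    ‖matVec Wᵀ x‖ = Real.sqrt (d / k) * ‖x‖ := by
  rw [← Real.sqrt_sq (norm_nonneg (matVec Wᵀ x)), norm_sq_matVec_transpose hW,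
    Real.sqrt_mul (by positivity), Real.sqrt_sq (norm_nonneg _)]

theorem norm_matVec_le {W : Matrix (Fin k) (Fin d) ℝ}
    (hW : W * Wᵀ = ((d : ℝ) / k) • (1 : Matrix (Fin k) (Fin k) ℝ)) (v : Euc d) :
    ‖matVec W v‖ ≤ Real.sqrt (d / k) * ‖v‖ := by
  have h1 : ‖matVec W v‖ ^ 2 ≤ ‖v‖ * (Real.sqrt (d / k) * ‖matVec W v‖) := by
    rw [← norm_matVec_transpose hW, ← real_inner_self_eq_norm_sq, inner_matVec_left]
    exact real_inner_le_norm _ _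
  rcases (norm_nonneg (matVec W v)).eq_or_lt with h0 | h0
  · rw [← h0]; positivity
  · nlinarith

theorem integrable_norm_matVec (hk : 1 ≤ k) (hkd : k ≤ d) {v : Euc d} :
    Integrable (fun W => ‖matVec W v‖) (rotationLaw k d) := by
  have := isProbabilityMeasure_rotationLaw hkd
  refine Integrable.of_bound (C := Real.sqrt (d / k) * ‖v‖)
    (by fun_prop : Measurable _).aestronglyMeasurable ?_
  filter_upwards [ae_rotationLaw_mul_transpose hk] with W hW
  rw [norm_norm]
  exact norm_matVec_le hW v

theorem Gamma_half_pos {m : ℕ} (hm : 1 ≤ m) :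
    0 < Real.Gamma ((m + 1) / 2) ∧ 0 < Real.Gamma ((m : ℝ) / 2) := by
  have : (0 : ℝ) < m := by exact_mod_cast hm
  exact ⟨Real.Gamma_pos_of_pos (by positivity), Real.Gamma_pos_of_pos (by positivity)⟩

/-- The mean length of the projection of a unit vector is `1 / c`. -/
theorem unbiasConst_mul_integral_norm (hk : 1 ≤ k) (hkd : k ≤ d) {v : Euc d} (hv : ‖v‖ = 1) :
    unbiasConst k d * ∫ W, ‖matVec W v‖ ∂(rotationLaw k d) = 1 := by
  have hk0 : (0 : ℝ) < k := by exact_mod_cast hk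
  have hd0 : (0 : ℝ) < d := by exact_mod_cast hk.trans hkd
  have h := lintegral_norm_smul_matVec hk hkd hv (F := fun x => ‖x‖ₑ) (by fun_prop)
  -- polar decomposition, read as `E ‖g‖ * E ‖W v‖ = √(d/k) * E ‖x‖`
  simp_rw [enorm_smul] at h
  have hint : ∀ m : ℕ, Integrable (fun g : Euc m => g) (stdGaussian (Euc m)) := fun m =>
    IsGaussian.integrable_id
  have hreal : ∀ m : ℕ, ∫⁻ g, ‖g‖ₑ ∂(stdGaussian (Euc m)) =
      ENNReal.ofReal (∫ g, ‖g‖ ∂(stdGaussian (Euc m))) := fun m =>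
    (ofReal_integral_norm_eq_lintegral_enorm (hint m)).symm
  have hW : ∫⁻ W, ‖matVec W v‖ₑ ∂(rotationLaw k d) =
      ENNReal.ofReal (∫ W, ‖matVec W v‖ ∂(rotationLaw k d)) := by
    have := ofReal_integral_norm_eq_lintegral_enorm (integrable_norm_matVec hk hkd (v := v))
    simp only [norm_norm, enorm_norm] at this
    exact this.symm
  simp_rw [lintegral_const_mul' _ _ enorm_ne_top, enorm_norm] at h
  rw [lintegral_mul_const _ (by fun_prop), hreal, hreal, hW,
    Real.enorm_of_nonneg (Real.sqrt_nonneg _),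
    ← ENNReal.ofReal_mul (integral_nonneg fun _ => norm_nonneg _),
    ← ENNReal.ofReal_mul (Real.sqrt_nonneg _)] at h
  have h' := (ENNReal.ofReal_eq_ofReal_iff
    (mul_nonneg (integral_nonneg fun _ => norm_nonneg _) (integral_nonneg fun _ => norm_nonneg _))
    (mul_nonneg (Real.sqrt_nonneg _) (integral_nonneg fun _ => norm_nonneg _))).1 h
  rw [integral_norm_stdGaussian hk, integral_norm_stdGaussian (hk.trans hkd)] at h'
  obtain ⟨h1, h2⟩ := Gamma_half_pos hk
  obtain ⟨h3, h4⟩ := Gamma_half_pos (hk.trans hkd)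
  have hs : Real.sqrt (k / d) * Real.sqrt (d / k) = 1 := by
    rw [← Real.sqrt_mul (by positivity), div_mul_div_cancel₀ hd0.ne', div_self hk0.ne',
      Real.sqrt_one]
  have hs2 : 0 < Real.sqrt 2 := by positivity
  generalize ∫ W, ‖matVec W v‖ ∂(rotationLaw k d) = I at *
  have hI : I = Real.sqrt (d / k) * (Real.Gamma ((k + 1) / 2) / Real.Gamma (k / 2)) *
      (Real.Gamma (d / 2) / Real.Gamma ((d + 1) / 2)) := by
    have hne : Real.sqrt 2 * Real.Gamma ((d + 1) / 2) / Real.Gamma (d / 2) ≠ 0 := by positivity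
    apply mul_left_cancel₀ hne
    rw [h']
    field_simp
  rw [hI, unbiasConst]
  calc _ = Real.sqrt (k / d) * Real.sqrt (d / k) := by field_simp
    _ = 1 := hs

theorem integrable_unbiased (hk : 1 ≤ k) (hkd : k ≤ d) {v : Euc d} :
    Integrable (fun W => matVec Wᵀ (normalizeVec (matVec W v))) (rotationLaw k d) := by
  have := isProbabilityMeasure_rotationLaw hkd
  refine Integrable.of_bound (C := Real.sqrt (d / k) * 1)
    (by fun_prop : Measurable _).aestronglyMeasurable ?_
  filter_upwards [ae_rotationLaw_mul_transpose hk] with W hW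
  rw [norm_matVec_transpose hW]
  gcongr
  exact norm_normalizeVec_le _

/-- By invariance under the reflection in the line spanned by `v`, the mean of `Wᵀ u` is a multiple
of `v`, and its component along `v` is the mean of `⟨u, W v⟩ = ‖W v‖`. -/
theorem integral_unbiased (hk : 1 ≤ k) (hkd : k ≤ d) {v : Euc d} (hv : ‖v‖ = 1) :
    ∫ W, unbiasConst k d • matVec Wᵀ (normalizeVec (matVec W v)) ∂(rotationLaw k d) = v := by
  set Q := lineReflection v
  have hQ : Q ∈ Matrix.orthogonalGroup (Fin d) ℝ := lineReflection_mem_orthogonalGroup hv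
  have hQt : Qᵀ = Q := transpose_lineReflection v
  have hQv : matVec Q v = v := by
    rw [matVec_lineReflection, real_inner_self_eq_norm_sq, hv, one_pow, mul_one, two_smul,
      add_sub_cancel_right]
  have hint := integrable_unbiased hk hkd (v := v)
  set x := ∫ W, matVec Wᵀ (normalizeVec (matVec W v)) ∂(rotationLaw k d) with hx
  -- replacing `W` by `W Q` changes neither the law of `W` nor `W v`, and turns `Wᵀ` into `Q Wᵀ`
  have hQx : matVec Q x = x := by
    conv_rhs => rw [hx, ← map_mul_right_rotationLaw hkd hQ]
    rw [integral_map (measurable_matrix_mul_const Q).aemeasurable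
      (by fun_prop : Measurable _).aestronglyMeasurable]
    simp_rw [matVec_mul, hQv, Matrix.transpose_mul, hQt, matVec_mul, ← matVecCLM_apply Q]
    rw [ContinuousLinearMap.integral_comp_comm _ hint]
  have hvx : (inner ℝ v x : ℝ) = ∫ W, ‖matVec W v‖ ∂(rotationLaw k d) := by
    rw [hx, ← integral_inner hint]
    congr 1
    ext W
    rw [← inner_matVec_left, inner_normalizeVec]
  have hxv : x = (inner ℝ v x : ℝ) • v := by
    rw [matVec_lineReflection, sub_eq_iff_eq_add, ← two_smul ℝ x, mul_smul] at hQx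
    exact (smul_right_injective _ (two_ne_zero (α := ℝ)) hQx).symm
  rw [integral_smul, ← hx, hxv, hvx, smul_smul, unbiasConst_mul_integral_norm hk hkd hv, one_smul]

end

/-! ### Privacy, bias and error of the projected randomizer -/

section
variable {k d : ℕ}

@[fun_prop]
theorem measurable_pugOutput {Ω : Type*} [MeasurableSpace Ω] (p q : ℝ) {u : Ω → Euc k}
    {ω : Ω → ℝ × Euc k} (hu : Measurable u) (hω : Measurable ω) :
    Measurable fun x => pugOutput p q (u x) (ω x) := by
  unfold pugOutput; fun_prop

@[fun_prop]
theorem measurable_recombine {Ω : Type*} [MeasurableSpace Ω] {u : Ω → Euc k}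
    {ω : Ω → ℝ × Euc k} (hu : Measurable u) (hω : Measurable ω) :
    Measurable fun x => recombine (u x) (ω x) := by
  unfold recombine; fun_prop

@[fun_prop]
theorem measurable_decodeMsg :
    Measurable (decodeMsg : Matrix (Fin k) (Fin d) ℝ × Euc k → Euc d) := by
  unfold decodeMsg; fun_prop

theorem isProbabilityMeasure_pugCoins (hk : 1 ≤ k) {ε p q : ℝ} (h : PugAdmissible ε p q) :
    IsProbabilityMeasure (pugCoins k p q) := by
  obtain ⟨hp0, hp1, hq0, hq1, -, -⟩ := h
  have := isProbabilityMeasure_stdAlphaLaw hp0.le hp1.le hq0 hq1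
  rw [pugCoins_eq_map hk hp0.le hp1.le hq0 hq1]
  exact Measure.isProbabilityMeasure_map (by fun_prop)

/-- Conditionally on `W`, which does not depend on the input, the message is a function of the
output of PrivUnitG on a unit vector. -/
theorem isLocallyDP_projRandomizer (hk : 1 ≤ k) (hkd : k ≤ d) {ε p q : ℝ}
    (h : PugAdmissible ε p q) : IsLocallyDP ε (projRandomizer k d p q) := by
  intro v w hv hw S hS
  have := isProbabilityMeasure_rotationLaw hkd
  have := isProbabilityMeasure_pugCoins hk h
  have hm : ∀ v : Euc d, Measurable fun x : Matrix (Fin k) (Fin d) ℝ × ℝ × Euc k =>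
      (x.1, unbiasConst k d • pugOutput p q (normalizeVec (matVec x.1 v)) x.2) := fun v => by
    fun_prop
  have hS' : ∀ W : Matrix (Fin k) (Fin d) ℝ,
      MeasurableSet {y : Euc k | (W, unbiasConst k d • y) ∈ S} := fun W =>
    (by fun_prop : Measurable fun y : Euc k => (W, unbiasConst k d • y)) hS
  have key : ∀ v : Euc d, projRandomizer k d p q v S =
      ∫⁻ W, pug k p q (normalizeVec (matVec W v)) {y | (W, unbiasConst k d • y) ∈ S}
        ∂(rotationLaw k d) := by
    intro v
    rw [projRandomizer, Measure.map_apply (hm v) hS, Measure.prod_apply (hm v hS)]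
    congr 1
    ext W
    rw [pug, Measure.map_apply (by fun_prop) (hS' W)]
    rfl
  rw [key, key, ← lintegral_const_mul' _ _ ENNReal.ofReal_ne_top]
  apply lintegral_mono_ae
  filter_upwards [ae_matVec_ne_zero hk hkd hv, ae_matVec_ne_zero hk hkd hw] with W h1 h2
  exact isLocallyDP_pug hk h _ _ (norm_normalizeVec h1) (norm_normalizeVec h2) _ (hS' W)

theorem isProbabilityMeasure_projRandomizer (hk : 1 ≤ k) (hkd : k ≤ d) {ε p q : ℝ}
    (h : PugAdmissible ε p q) (v : Euc d) : IsProbabilityMeasure (projRandomizer k d p q v) := by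
  have := isProbabilityMeasure_rotationLaw hkd
  have := isProbabilityMeasure_pugCoins hk h
  exact Measure.isProbabilityMeasure_map (by fun_prop)

theorem projRandomizer_eq_map (hk : 1 ≤ k) (hkd : k ≤ d) {ε p q : ℝ} (h : PugAdmissible ε p q)
    (v : Euc d) :
    projRandomizer k d p q v =
      ((rotationLaw k d).prod ((stdAlphaLaw p q).prod (stdGaussian (Euc k)))).map fun x =>
        (x.1, unbiasConst k d • (pugSignal p q)⁻¹ •
          recombine (normalizeVec (matVec x.1 v)) x.2) := by
  obtain ⟨hp0, hp1, hq0, hq1, -, -⟩ := h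
  have := isProbabilityMeasure_stdAlphaLaw hp0.le hp1.le hq0 hq1
  have := isProbabilityMeasure_rotationLaw hkd
  have hm : Measurable (Prod.map (pugSigma k * ·) (id : Euc k → Euc k)) :=
    (measurable_const_mul _).prodMap measurable_id
  rw [projRandomizer, pugCoins_eq_map hk hp0.le hp1.le hq0 hq1]
  conv_lhs => rw [← Measure.map_id (μ := rotationLaw k d),
    Measure.map_prod_map _ _ measurable_id hm,
    Measure.map_map (by fun_prop) (measurable_id.prodMap hm)]
  congr 1
  ext1 x
  simp only [Function.comp, Prod.map_fst, Prod.map_snd, id, pugOutput_scale hk]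

theorem memLp_decode (hk : 1 ≤ k) (hkd : k ≤ d) {ε p q : ℝ} (h : PugAdmissible ε p q) (v : Euc d)
    (r r' : ℝ) :
    MemLp (fun x : Matrix (Fin k) (Fin d) ℝ × ℝ × Euc k =>
        matVec x.1ᵀ (r • r' • recombine (normalizeVec (matVec x.1 v)) x.2)) 2
      ((rotationLaw k d).prod ((stdAlphaLaw p q).prod (stdGaussian (Euc k)))) := by
  obtain ⟨hp0, hp1, hq0, hq1, -, -⟩ := h
  have := isProbabilityMeasure_stdAlphaLaw hp0.le hp1.le hq0 hq1
  have := isProbabilityMeasure_rotationLaw hkd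
  have hb := ((memLp_recombineBound k hp0.le hp1.le hq0 hq1).comp_snd (rotationLaw k d)).const_mul
    (Real.sqrt (d / k) * (|r| * |r'|))
  refine hb.mono' (by fun_prop : Measurable _).aestronglyMeasurable ?_
  filter_upwards [Measure.quasiMeasurePreserving_fst.ae (ae_rotationLaw_mul_transpose hk)]
    with x hx
  rw [norm_matVec_transpose hx, norm_smul, norm_smul, Real.norm_eq_abs, Real.norm_eq_abs,
    mul_assoc, mul_assoc]
  gcongr
  exact norm_recombine_le (norm_normalizeVec_le _) _

theorem memLp_decodeMsg (hk : 1 ≤ k) (hkd : k ≤ d) {ε p q : ℝ} (h : PugAdmissible ε p q)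
    (v : Euc d) : MemLp decodeMsg 2 (projRandomizer k d p q v) := by
  rw [projRandomizer_eq_map hk hkd h, memLp_map_measure_iff
    measurable_decodeMsg.aestronglyMeasurable (by fun_prop)]
  exact memLp_decode hk hkd h v _ _

theorem integrable_decodeMsg (hk : 1 ≤ k) (hkd : k ≤ d) {ε p q : ℝ} (h : PugAdmissible ε p q)
    (v : Euc d) : Integrable decodeMsg (projRandomizer k d p q v) := by
  have := isProbabilityMeasure_projRandomizer hk hkd h v
  exact (memLp_decodeMsg hk hkd h v).integrable (by norm_num)

theorem integral_decodeMsg (hk : 1 ≤ k) (hkd : k ≤ d) {ε p q : ℝ} (h : PugAdmissible ε p q)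
    {v : Euc d} (hv : ‖v‖ = 1) : ∫ m, decodeMsg m ∂(projRandomizer k d p q v) = v := by
  have hL := memLp_decode hk hkd h v (unbiasConst k d) (pugSignal p q)⁻¹
  have hs := h.pugSignal_pos
  rw [projRandomizer_eq_map hk hkd h, integral_map (by fun_prop)
    measurable_decodeMsg.aestronglyMeasurable]
  obtain ⟨hp0, hp1, hq0, hq1, -, -⟩ := h
  have := isProbabilityMeasure_stdAlphaLaw hp0.le hp1.le hq0 hq1
  have := isProbabilityMeasure_rotationLaw hkd
  simp only [decodeMsg]
  rw [integral_prod _ (hL.integrable (by norm_num))]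
  conv_rhs => rw [← integral_unbiased hk hkd hv]
  congr 1
  ext1 W
  have hi := (memLp_recombine hp0.le hp1.le hq0 hq1
    (norm_normalizeVec_le (matVec W v))).integrable (by norm_num)
  simp_rw [← matVecCLM_apply Wᵀ]
  have hi2 : Integrable (fun ω => unbiasConst k d • (pugSignal p q)⁻¹ •
      recombine (normalizeVec (matVec W v)) ω)
      ((stdAlphaLaw p q).prod (stdGaussian (Euc k))) :=
    (hi.smul (pugSignal p q)⁻¹).smul (unbiasConst k d)
  rw [ContinuousLinearMap.integral_comp_comm _ hi2, integral_smul, integral_smul,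
    integral_recombine hp0.le hp1.le hq0 hq1, smul_smul _ (pugSignal p q), inv_mul_cancel₀ hs.ne',
    one_smul, map_smul]

theorem integral_norm_sq_decodeMsg (hk : 1 ≤ k) (hkd : k ≤ d) {ε p q : ℝ}
    (h : PugAdmissible ε p q) {v : Euc d} (hv : ‖v‖ = 1) :
    ∫ m, ‖decodeMsg m‖ ^ 2 ∂(projRandomizer k d p q v) =
      d / k * unbiasConst k d ^ 2 * pugSecondMoment k p q := by
  have hL := memLp_decode hk hkd h v (unbiasConst k d) (pugSignal p q)⁻¹
  rw [projRandomizer_eq_map hk hkd h, integral_map (by fun_prop)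
    (by fun_prop : Measurable _).aestronglyMeasurable]
  have h' := h
  obtain ⟨hp0, hp1, hq0, hq1, -, -⟩ := h
  have := isProbabilityMeasure_stdAlphaLaw hp0.le hp1.le hq0 hq1
  have := isProbabilityMeasure_rotationLaw hkd
  simp only [decodeMsg]
  rw [integral_prod _ (hL.integrable_norm_pow (by norm_num))]
  have key : ∀ᵐ W ∂(rotationLaw k d), ∫ ω, ‖matVec Wᵀ (unbiasConst k d • (pugSignal p q)⁻¹ •
      recombine (normalizeVec (matVec W v)) ω)‖ ^ 2
        ∂((stdAlphaLaw p q).prod (stdGaussian (Euc k))) =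
      d / k * unbiasConst k d ^ 2 * pugSecondMoment k p q := by
    filter_upwards [ae_rotationLaw_mul_transpose hk, ae_matVec_ne_zero hk hkd hv] with W hW h0
    simp_rw [norm_sq_matVec_transpose hW]
    rw [integral_const_mul, integral_norm_sq_smul_recombine h' (norm_normalizeVec h0), mul_assoc]
  rw [integral_congr_ae key]
  simp

theorem protocolMSE_projRandomizer {n : ℕ} (hn : 1 ≤ n) (hk : 1 ≤ k) (hkd : k ≤ d) {ε p q : ℝ}
    (h : PugAdmissible ε p q) {v : Fin n → Euc d} (hv : ∀ i, ‖v i‖ = 1) :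
    protocolMSE projAggregate (projRandomizer k d p q) v =
      ENNReal.ofReal ((d / k * unbiasConst k d ^ 2 * pugSecondMoment k p q - 1) / n) := by
  have := fun i => isProbabilityMeasure_projRandomizer hk hkd h (v i)
  exact lintegral_meanVec_sub_eq hn (fun i => projRandomizer k d p q (v i))
    (fun i => memLp_decodeMsg hk hkd h (v i)) (fun i => integral_decodeMsg hk hkd h (hv i)) hv
    (fun i => integral_norm_sq_decodeMsg hk hkd h (hv i))

end

/-! ### The inflation factor of the second moment -/

theorem Gamma_add_half_sq_le {x : ℝ} (hx : 0 < x) :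
    Real.Gamma (x + 1 / 2) ^ 2 ≤ x * Real.Gamma x ^ 2 := by
  have h := Real.Gamma_mul_add_mul_le_rpow_Gamma_mul_rpow_Gamma (s := x) (t := x + 1) (a := 1 / 2)
    (b := 1 / 2) hx (by linarith) (by norm_num) (by norm_num) (by norm_num)
  have e : 1 / 2 * x + 1 / 2 * (x + 1) = x + 1 / 2 := by ring
  rw [e, Real.Gamma_add_one hx.ne', ← Real.sqrt_eq_rpow, ← Real.sqrt_eq_rpow] at h
  have hG := Real.Gamma_pos_of_pos hx
  have h0 := Real.Gamma_pos_of_pos (by linarith : 0 < x + 1 / 2)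
  calc Real.Gamma (x + 1 / 2) ^ 2
      ≤ (Real.sqrt (Real.Gamma x) * Real.sqrt (x * Real.Gamma x)) ^ 2 := by gcongr
    _ = x * Real.Gamma x ^ 2 := by
      rw [mul_pow, Real.sq_sqrt hG.le, Real.sq_sqrt (by positivity)]; ring

theorem inflation_eq {k d : ℕ} (hk : 1 ≤ k) (hkd : k ≤ d) :
    d / k * unbiasConst k d ^ 2 =
      Real.Gamma ((d + 1) / 2) ^ 2 / Real.Gamma (d / 2) ^ 2 *
        (Real.Gamma (k / 2) ^ 2 / Real.Gamma ((k + 1) / 2) ^ 2) := by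
  have hk0 : (0 : ℝ) < k := by exact_mod_cast hk
  have hd0 : (0 : ℝ) < d := by exact_mod_cast hk.trans hkd
  rw [unbiasConst, div_pow, mul_pow, Real.sq_sqrt (by positivity)]
  field_simp

theorem inflation_le {k d : ℕ} (hk : 1 ≤ k) (hkd : k ≤ d) {a : ℝ} (ha : 0 < a)
    (h : a * Real.Gamma (k / 2) ^ 2 ≤ 2 * Real.Gamma ((k + 1) / 2) ^ 2) :
    d / k * unbiasConst k d ^ 2 ≤ d / a := by
  have hd0 : (0 : ℝ) < d := by exact_mod_cast hk.trans hkd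
  obtain ⟨h1, h2⟩ := Gamma_half_pos hk
  obtain ⟨h3, h4⟩ := Gamma_half_pos (hk.trans hkd)
  have hd := Gamma_add_half_sq_le (half_pos hd0)
  rw [show (d : ℝ) / 2 + 1 / 2 = (d + 1) / 2 by ring] at hd
  rw [inflation_eq hk hkd]
  calc _ ≤ ((d : ℝ) / 2) * (2 / a) := by
        refine mul_le_mul ?_ ?_ (by positivity) (by positivity)
        · rwa [div_le_iff₀ (by positivity)]
        · rw [div_le_div_iff₀ (by positivity) ha]; linarith
    _ = d / a := by field_simp

theorem inflation_le_of_two_le {k d : ℕ} (hk : 2 ≤ k) (hkd : k ≤ d) :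
    d / k * unbiasConst k d ^ 2 ≤ d / ((k : ℝ) - 1) := by
  have hk2 : (2 : ℝ) ≤ k := by exact_mod_cast hk
  have hx : 0 < ((k : ℝ) - 1) / 2 := by linarith
  refine inflation_le (by omega) hkd (by linarith) ?_
  have h := Gamma_add_half_sq_le hx
  have h2 := Real.Gamma_add_one hx.ne'
  rw [show ((k : ℝ) - 1) / 2 + 1 / 2 = k / 2 by ring] at h
  rw [show ((k : ℝ) - 1) / 2 + 1 = (k + 1) / 2 by ring] at h2
  rw [h2]
  nlinarith

theorem inflation_le_one {d : ℕ} (hd : 1 ≤ d) :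
    d / (1 : ℕ) * unbiasConst 1 d ^ 2 ≤ d / (2 / Real.pi) := by
  refine inflation_le le_rfl hd (by positivity) ?_
  have : ((1 : ℕ) + 1 : ℝ) / 2 = 1 := by norm_num
  rw [this, Real.Gamma_one, Nat.cast_one, Real.Gamma_one_half_eq, Real.sq_sqrt Real.pi_pos.le]
  field_simp
  norm_num

theorem inflation_self {d : ℕ} (hd : 1 ≤ d) : d / d * unbiasConst d d ^ 2 = 1 := by
  obtain ⟨h3, h4⟩ := Gamma_half_pos hd
  rw [inflation_eq hd le_rfl]
  field_simp

/-! ### The error bound -/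

theorem mse_le_of_error_le {n k d : ℕ} (hn : 1 ≤ n) (hk : 1 ≤ k) (hkd : k ≤ d) {ε p q p' q' : ℝ}
    (h : PugAdmissible ε p q) (h' : PugAdmissible ε p' q') {x : ℝ} (hx : 0 ≤ x)
    (hle : d / k * unbiasConst k d ^ 2 * pugSecondMoment k p q - 1 ≤
      (pugSecondMoment d p' q' - 1) * (1 + x))
    {v : Fin n → Euc d} (hv : ∀ i, ‖v i‖ = 1) :
    protocolMSE projAggregate (projRandomizer k d p q) v ≤
      pugErr n d p' q' * ENNReal.ofReal (1 + x) := by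
  have hn0 : (0 : ℝ) < n := by exact_mod_cast hn
  rw [protocolMSE_projRandomizer hn hk hkd h hv, pugErr_eq hn (hk.trans hkd) h',
    ← ENNReal.ofReal_mul' (by linarith)]
  refine ENNReal.ofReal_le_ofReal ?_
  rw [div_mul_eq_mul_div (pugSecondMoment d p' q' - 1)]
  exact div_le_div_of_nonneg_right hle hn0.le

theorem pugSecondMoment_sub_one_nonneg {d : ℕ} (hd : 1 ≤ d) {ε p q : ℝ} (h : PugAdmissible ε p q) :
    0 ≤ pugSecondMoment d p q - 1 := by
  refine le_trans ?_ (pugSecondMoment_sub_one_ge h d)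
  have hd1 : (1 : ℝ) ≤ d := by exact_mod_cast hd
  exact div_nonneg (by linarith) (sq_nonneg _)

theorem mse_le_of_two_le {ε : ℝ} (hε : 0 < ε) {C : ℝ} (hC : 32 ≤ C) {n k d : ℕ} (hn : 1 ≤ n)
    (hk : 2 ≤ k) (hkd : k ≤ d) {p q p' q' : ℝ} (h : PugOptimal ε k p q)
    (h' : PugAdmissible ε p' q') {v : Fin n → Euc d} (hv : ∀ i, ‖v i‖ = 1) :
    protocolMSE projAggregate (projRandomizer k d p q) v ≤
      pugErr n d p' q' * ENNReal.ofReal (1 + C * ((ε + Real.log k) / k)) := by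
  have hk2 : (2 : ℝ) ≤ k := by exact_mod_cast hk
  have hkd' : (k : ℝ) ≤ d := by exact_mod_cast hkd
  have hlog : 1 / 2 ≤ Real.log k := by
    have h2 := Real.log_le_log (by norm_num) hk2
    linarith [Real.log_two_gt_d9]
  have hx : 0 ≤ C * ((ε + Real.log k) / k) := by positivity
  refine mse_le_of_error_le hn (by omega) hkd h.1 h' hx ?_ hv
  refine (inflated_error_le hε (by omega) (by omega) h h' (by linarith) (by linarith)
    (by linarith) (inflation_le_of_two_le hk hkd)).trans ?_
  refine mul_le_mul_of_nonneg_left ?_ (pugSecondMoment_sub_one_nonneg (by omega) h')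
  gcongr 1 + ?_
  calc (4 + 16 * ε) / ((k : ℝ) - 1) ≤ (8 + 32 * ε) / k := by
        rw [div_le_div_iff₀ (by linarith) (by linarith)]
        nlinarith
    _ ≤ C * (ε + Real.log k) / k := by
        gcongr
        nlinarith
    _ = _ := by ring

/-- For `k = 1` the term `log k` vanishes and the error is inflated by a factor that stays away from
`1` as `ε → 0`, so the constant has to depend on `ε`. -/
theorem mse_le_one {ε : ℝ} (hε : 0 < ε) {C : ℝ} (hC : (2 + 8 * ε) * Real.pi / ε ≤ C) {n d : ℕ}
    (hn : 1 ≤ n) (hd : 1 ≤ d) {p q p' q' : ℝ} (h : PugOptimal ε 1 p q)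
    (h' : PugAdmissible ε p' q') {v : Fin n → Euc d} (hv : ∀ i, ‖v i‖ = 1) :
    protocolMSE projAggregate (projRandomizer 1 d p q) v ≤
      pugErr n d p' q' * ENNReal.ofReal (1 + C * ((ε + Real.log (1 : ℕ)) / (1 : ℕ))) := by
  have hpi := Real.pi_gt_three
  have hCε : (2 + 8 * ε) * Real.pi ≤ C * ε := (div_le_iff₀ hε).1 hC
  have e : C * ((ε + Real.log (1 : ℕ)) / (1 : ℕ)) = C * ε := by simp
  have hx : 0 ≤ C * ε := le_trans (by positivity) hCε
  have hB := pugSecondMoment_sub_one_nonneg hd h'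
  rw [e]
  refine mse_le_of_error_le hn le_rfl hd h.1 h' hx ?_ hv
  rcases hd.eq_or_lt with rfl | hd2
  · rw [inflation_self le_rfl, one_mul]
    have := h.secondMoment_le le_rfl h'
    nlinarith
  · have hd2' : (2 : ℝ) ≤ d := by exact_mod_cast hd2
    have ha : 0 < 2 / Real.pi := by positivity
    have ha1 : 2 / Real.pi ≤ 1 := by rw [div_le_one Real.pi_pos]; linarith
    refine (inflated_error_le hε le_rfl hd2 h h' ha (by linarith)
      (by push_cast; linarith) (inflation_le_one hd)).trans ?_
    refine mul_le_mul_of_nonneg_left ?_ hB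
    have e2 : (4 + 16 * ε) / (2 / Real.pi) = (2 + 8 * ε) * Real.pi := by
      field_simp
      ring
    rw [e2]
    linarith

theorem mainTheorem6 :
    -- optimized parameters exist
    (∀ ε : ℝ, 0 < ε → ∀ d : ℕ, 1 ≤ d → ∃ p q : ℝ, PugOptimal ε d p q) ∧
    -- unbiasedness and privacy
    (∀ ε : ℝ, 0 < ε → ∀ k d : ℕ, 1 ≤ k → k ≤ d → ∀ p q : ℝ, PugOptimal ε k p q →
      (∀ v : Euc d, ‖v‖ = 1 →
        (Integrable
            (fun W => unbiasConst k d • matVec Wᵀ (normalizeVec (matVec W v)))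
            (rotationLaw k d) ∧
          ∫ W, unbiasConst k d • matVec Wᵀ (normalizeVec (matVec W v)) ∂(rotationLaw k d) = v) ∧
        (Integrable decodeMsg (projRandomizer k d p q v) ∧
          ∫ m, decodeMsg m ∂(projRandomizer k d p q v) = v)) ∧
      IsLocallyDP ε (projRandomizer k d p q)) ∧
    -- mean squared error, with a universal constant, for `k ≥ 2`
    (∃ C : ℝ, 0 < C ∧ ∀ ε : ℝ, 0 < ε → ∀ n k d : ℕ, 1 ≤ n → 2 ≤ k → k ≤ d →
      ∀ p q : ℝ, PugOptimal ε k p q → ∀ p' q' : ℝ, PugOptimal ε d p' q' →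
      ∀ v : Fin n → Euc d, (∀ i, ‖v i‖ = 1) →
        protocolMSE projAggregate (projRandomizer k d p q) v ≤
          pugErr n d p' q' * ENNReal.ofReal (1 + C * ((ε + Real.log k) / k))) ∧
    -- mean squared error, with a constant depending on `ε`, for all `k ≥ 1`
    (∀ ε : ℝ, 0 < ε → ∃ C : ℝ, 0 < C ∧ ∀ n k d : ℕ, 1 ≤ n → 1 ≤ k → k ≤ d →
      ∀ p q : ℝ, PugOptimal ε k p q → ∀ p' q' : ℝ, PugOptimal ε d p' q' →
      ∀ v : Fin n → Euc d, (∀ i, ‖v i‖ = 1) →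
        protocolMSE projAggregate (projRandomizer k d p q) v ≤
          pugErr n d p' q' * ENNReal.ofReal (1 + C * ((ε + Real.log k) / k))) := by
  refine ⟨fun ε hε d hd => exists_pugOptimal hε hd, fun ε hε k d hk hkd p q h => ⟨fun v hv =>
      ⟨⟨(integrable_unbiased hk hkd).smul (unbiasConst k d), integral_unbiased hk hkd hv⟩,
        integrable_decodeMsg hk hkd h.1 v, integral_decodeMsg hk hkd h.1 hv⟩,
      isLocallyDP_projRandomizer hk hkd h.1⟩, ⟨32, by norm_num, ?_⟩, fun ε hε =>
      ⟨max 32 ((2 + 8 * ε) * Real.pi / ε), lt_max_of_lt_left (by norm_num), ?_⟩⟩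
  · intro ε hε n k d hn hk hkd p q h p' q' h' v hv
    exact mse_le_of_two_le hε le_rfl hn hk hkd h h'.1 hv
  · intro n k d hn hk hkd p q h p' q' h' v hv
    rcases hk.eq_or_lt with rfl | hk2
    · exact mse_le_one hε (le_max_right _ _) hn hkd h h'.1 hv
    · exact mse_le_of_two_le hε (le_max_left _ _) hn hk2 hkd h h'.1 hv
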